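/- Write $p^0=\sqrt{1+|p|^2}$ and $p^\mu=(p^0,p)\in\mathbb R^4$ for $p\in\mathbb R^3$, and let $x^\mu y_\mu=-x^0y^0+\sum_{i=1}^3x^iy^i$. For 4-vectors put $s(x^\mu,y^\mu)=-(x^\mu+y^\mu)(x_\mu+y_\mu)$ and $g(x^\mu,y^\mu)=\sqrt{(x^\mu-y^\mu)(x_\mu-y_\mu)}$. Let the scattering kernel $\sigma=\sigma(g,\theta)\ge 0$ be measurable. In the integrals below, $s=s(p^\mu,q^\mu)$ and $\sigma=\sigma(g,\theta)$ with $g=g(p^\mu,q^\mu)$ and the scattering angle $\theta\in[0,\pi]$ given by $\cos\theta=(p^\mu-q^\mu)(p'_\mu-q'_\mu)/g^2$. For measurable $f,h:\mathbb R^3\to[0,\infty)$ and $p\in\mathbb R^3$, the relativistic gain operator is $$Q^+(f,h)(p)=\frac1{p^0}\int_{\mathbb R^3}\frac{dq}{q^0}\int_{\mathbb R^3}\frac{dq'}{q'^0}\int_{\mathbb R^3}\frac{dp'}{p'^0}\;\tfrac12\, s\,\sigma(g,\theta)\,\delta^{(4)}(p^\mu+q^\mu-p'^\mu-q'^\mu)\,f(p')h(q')\in[0,\infty],$$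 where, for fixed $p$, $\delta^{(4)}(p^\mu+q^\mu-p'^\mu-q'^\mu)\,dq\,dq'\,dp'$ is the locally finite measure on $(\mathbb R^3)^3$ that is the limit, against continuous compactly supported test functions, of $\delta_\varepsilon(p^\mu+q^\mu-p'^\mu-q'^\mu)\,dq\,dq'\,dp'$ as $\varepsilon\to0^+$, for every mollifier $\delta_\varepsilon(y)=\varepsilon^{-4}\eta(y/\varepsilon)$ on $\mathbb R^4$ ($\eta\ge0$ continuous, compactly supported, $\int\eta=1$). **Proposition (relativistic Carleman representation).** For every measurable $f:\mathbb R^3\to[0,\infty)$ and every $p\in\mathbb R^3$, $$Q^+(f,f)(p)=\frac1{2p^0}\int_{\mathbb R^3}\frac{dp'}{p'^0}\,f(p')\int_{(p'^\mu-p^\mu)(q'_\mu-p_\mu)=0}\frac{d\pi_{q'}}{q'^0}\;\frac{s\,\sigma\,u(p'^0+q'^0-p^0)\,f(q')}{\left|(p'^0-p^0)\frac{q'}{q'^0}-(p'-p)\right|}$$ as an identity in $[0,\infty]$. Here $q^\mu=p'^\mu+q'^\mu-p^\mu$ in $s$ and $\sigma$, $u(x)=1$ for $x>0$ and $u(x)=0$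 for $x\le0$, and $d\pi_{q'}$ is the surface measure (two-dimensional Hausdorff measure) on the hypersurface $\{q'\in\mathbb R^3 : (p'^\mu-p^\mu)(q'_\mu-p_\mu)=0\}$. -/

import Mathlib

open MeasureTheory Filter Topology
open scoped NNReal ENNReal

namespace RelBoltz

/-- Momentum space `ℝ³` with its Euclidean norm. -/
abbrev E3 : Type := EuclideanSpace ℝ (Fin 3)

/-- 4-vectors `x^μ`, `μ = 0, 1, 2, 3`. -/
abbrev FourVec : Type := Fin 4 → ℝ

/-- The energy `p⁰ = √(1 + |p|²)` of a particle of momentum `p` (unit mass, unit speed of light). -/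
noncomputable def energy (p : E3) : ℝ := Real.sqrt (1 + ‖p‖ ^ 2)

/-- The energy-momentum vector `p^μ = (p⁰, p)`. -/
noncomputable def fourMom (p : E3) : FourVec := Fin.cons (energy p) (fun i => p i)

/-- The Lorentz product `x^μ y_μ`, of signature `(-, +, +, +)`. -/
def lorentz (x y : FourVec) : ℝ := -(x 0 * y 0) + ∑ i : Fin 3, x i.succ * y i.succ

/-- `s(x, y) = -(x^μ + y^μ)(x_μ + y_μ)`. -/
def sInv (x y : FourVec) : ℝ := -lorentz (x + y) (x + y)

/-- The relative momentum `g(x, y) = √((x^μ - y^μ)(x_μ - y_μ))`. -/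
noncomputable def gInv (x y : FourVec) : ℝ := Real.sqrt (lorentz (x - y) (x - y))

/-- The scattering angle `θ ∈ [0, π]`:
`cos θ = (p^μ - q^μ)(p'_μ - q'_μ) / g(p, q)²`, with arguments in the order `p, q, p', q'`. -/
noncomputable def scatAngle (P Q P' Q' : FourVec) : ℝ :=
  Real.arccos (lorentz (P - Q) (P' - Q') / gInv P Q ^ 2)

/-- The step function: `u(x) = 1` for `x > 0`, and `u(x) = 0` for `x ≤ 0`. -/
noncomputable def stepFn (x : ℝ) : ℝ := if 0 < x then 1 else 0

/-- `IsDeltaMeasure m Φ μ`: the measure `μ` is `δ⁽ⁿ⁾(Φ(x)) dm(x)`, the composition of the Dirac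
delta on `ℝⁿ` with `Φ`. That is, `μ` is locally finite and, for every mollifier
`η_ε(y) = ε⁻ⁿ η(y / ε)` on `ℝⁿ` (`η ≥ 0` continuous with compact support, `∫ η = 1`) and every test
function `φ`, one has `∫ φ(x) η_ε(Φ(x)) dm(x) → ∫ φ dμ` as `ε → 0⁺`. -/
def IsDeltaMeasure {X : Type*} [TopologicalSpace X] [MeasurableSpace X] (m : Measure X) {n : ℕ}
    (Φ : X → Fin n → ℝ) (μ : Measure X) : Prop :=
  IsFiniteMeasureOnCompacts μ ∧
    ∀ η : (Fin n → ℝ) → ℝ, Continuous η → HasCompactSupport η → (∀ y, 0 ≤ η y) → ∫ y, η y = 1 →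
      ∀ φ : X → ℝ, Continuous φ → HasCompactSupport φ →
        Tendsto (fun ε : ℝ => ∫ x, φ x * ((ε ^ n)⁻¹ * η (ε⁻¹ • Φ x)) ∂m) (𝓝[>] 0)
          (𝓝 (∫ x, φ x ∂μ))

open Classical in
/-- The measure `δ⁽ⁿ⁾(Φ(x)) dm(x)` (it is `0` by convention if the defining limits do not exist). -/
noncomputable def deltaMeasure {X : Type*} [TopologicalSpace X] [MeasurableSpace X]
    (m : Measure X) {n : ℕ} (Φ : X → Fin n → ℝ) : Measure X :=
  if h : ∃ μ, IsDeltaMeasure m Φ μ then h.choose else 0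

/-- The defining limits determine the measure. -/
theorem IsDeltaMeasure.unique {X : Type*} [TopologicalSpace X] [T2Space X] [LocallyCompactSpace X]
    [SecondCountableTopology X] [MeasurableSpace X] [BorelSpace X] {m : Measure X} {n : ℕ}
    {Φ : X → Fin n → ℝ} {μ ν : Measure X} (hμ : IsDeltaMeasure m Φ μ)
    (hν : IsDeltaMeasure m Φ ν) : μ = ν := by
  have := hμ.1
  have := hν.1
  let b : ContDiffBump (0 : Fin n → ℝ) := ⟨1, 2, by norm_num, by norm_num⟩
  refine Measure.ext_of_integral_eq_on_compactlySupported fun φ => ?_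
  exact tendsto_nhds_unique
    (hμ.2 _ b.continuous_normed b.hasCompactSupport_normed (fun y => b.nonneg_normed y)
      (b.integral_normed (μ := volume)) φ φ.continuous φ.hasCompactSupport)
    (hν.2 _ b.continuous_normed b.hasCompactSupport_normed (fun y => b.nonneg_normed y)
      (b.integral_normed (μ := volume)) φ φ.continuous φ.hasCompactSupport)

theorem IsDeltaMeasure.deltaMeasure_eq {X : Type*} [TopologicalSpace X] [T2Space X]
    [LocallyCompactSpace X] [SecondCountableTopology X] [MeasurableSpace X] [BorelSpace X]
    {m : Measure X} {n : ℕ} {Φ : X → Fin n → ℝ} {μ : Measure X} (hμ : IsDeltaMeasure m Φ μ) :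
    deltaMeasure m Φ = μ := by
  have h : ∃ μ, IsDeltaMeasure m Φ μ := ⟨μ, hμ⟩
  rw [deltaMeasure, dif_pos h]
  exact h.choose_spec.unique hμ

/-- The momentum-energy balance `p^μ + q^μ - p'^μ - q'^μ` as a function of `(q, q', p')`. -/
noncomputable def balance (p : E3) (x : E3 × E3 × E3) : FourVec :=
  fourMom p + fourMom x.1 - fourMom x.2.2 - fourMom x.2.1

/-- The transition rate without its delta function, `½ s σ(g, θ)`, for the collision
`(p, q) ↔ (p', q')` (arguments in the order `p, q, p', q'`). -/
noncomputable def rate (σ : ℝ → ℝ → ℝ≥0) (P Q P' Q' : FourVec) : ℝ :=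
  1 / 2 * sInv P Q * σ (gInv P Q) (scatAngle P Q P' Q')

/-- The gain operator
`Q⁺(f, h)(p) = (1/p⁰) ∫ dq/q⁰ ∫ dq'/q'⁰ ∫ dp'/p'⁰ W(p, q | p', q') f(p') h(q')` with
`W = ½ s σ(g, θ) δ⁽⁴⁾(p^μ + q^μ - p'^μ - q'^μ)`, for nonnegative `σ`, `f`, `h`, with values in
`[0, ∞]`. The integration variable is `x = (q, q', p')`. -/
noncomputable def gain (σ : ℝ → ℝ → ℝ≥0) (f h : E3 → ℝ≥0) (p : E3) : ℝ≥0∞ :=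
  ENNReal.ofReal (1 / energy p) *
    ∫⁻ x : E3 × E3 × E3,
      ENNReal.ofReal
        (rate σ (fourMom p) (fourMom x.1) (fourMom x.2.2) (fourMom x.2.1) * f x.2.2 * h x.2.1 /
          (energy x.1 * energy x.2.1 * energy x.2.2))
      ∂(deltaMeasure (volume : Measure (E3 × E3 × E3)) (balance p))

/-- The relativistic hypersurface `{q' ∈ ℝ³ | (p'^μ - p^μ)(q'_μ - p_μ) = 0}`. -/
def collSurface (p p' : E3) : Set E3 :=
  {q' | lorentz (fourMom p' - fourMom p) (fourMom q' - fourMom p) = 0}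

/-- The 4-vector `q^μ = p'^μ + q'^μ - p^μ` fixed by the conservation law. -/
noncomputable def qVec (p p' q' : E3) : FourVec := fourMom p' + fourMom q' - fourMom p

/-- `|(p'⁰ - p⁰) q'/q'⁰ - (p' - p)|`. -/
noncomputable def layerDenom (p p' q' : E3) : ℝ :=
  ‖((energy p' - energy p) / energy q') • q' - (p' - p)‖

end RelBoltz

/-! Fix `p` and `p' ≠ p`, and use cylindrical coordinates `(w, z)` for `q'` about the axis `p' - p`.
Since `|p'⁰ - p⁰| < |p' - p|`, the equation of the collision surface has exactly one solution `z =
height p p' w` for each `w`, so the surface is a graph over a plane, parametrized by `surf`.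

Let `t` be the height of `q'` above the graph and `u` the momentum defect. The map `(p', w, t, u) ↦
(q, q', p')` (`chart`) preserves volume. In these coordinates the momentum balance is exactly `u`,
and the energy balance vanishes at `t = 0`, `u = 0` with `t`-derivative `root / (q⁰ q'⁰)`. Scaling
`(t, u)` by `ε` absorbs the factor `ε⁻⁴` of the mollifier, and dominated convergence identifies the
delta measure as the image under `shell` of the density `q⁰ q'⁰ / root` in `(p', w)`
(`isDeltaMeasure_shellMeasure`). Near `p' = p` everything is dominated by `|p' - p|⁻¹`, which is
locally integrable on `ℝ³`.

The area formula writes the surface measure as `√(1 + |∇height|²) dw`. The denominator in the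
theorem is the gradient norm of the defining function of the surface, namely `(root / q'⁰) √(1 +
|∇height|²)` (`layerDenom_surf`). The square roots cancel and the two integrands agree. -/

namespace MeasureTheory

/-! ### Area formula for injective `C¹` immersions. -/

/-- Comparison of Hausdorff measures of two images of the same set. -/
theorem euclideanHausdorffMeasure_image_le_of_dist_le {α X Y : Type*} [MetricSpace X]
    [MeasurableSpace X] [BorelSpace X] [MetricSpace Y] [MeasurableSpace Y] [BorelSpace Y]
    {f : α → X} {g : α → Y} {A : Set α} {C : ℝ≥0} (d : ℕ)
    (h : ∀ y ∈ A, ∀ z ∈ A, dist (f y) (f z) ≤ C * dist (g y) (g z)) :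
    (μHE[d] : Measure X) (f '' A) ≤ (C : ℝ≥0∞) ^ d * (μHE[d] : Measure Y) (g '' A) := by
  rcases A.eq_empty_or_nonempty with rfl | ⟨a₀, ha₀⟩
  · simp
  have : Nonempty α := ⟨a₀⟩
  -- `g` need not be injective, but the hypothesis makes `f` constant on the fibres of `g` in `A`.
  -- So `f` factors through `g`, with a `C`-Lipschitz factor.
  set r := Function.invFunOn g A with hr
  have hrA : ∀ y ∈ A, r (g y) ∈ A := fun y hy => Function.invFunOn_apply_mem hy
  have hrg : ∀ y ∈ A, g (r (g y)) = g y := fun y hy => Function.invFunOn_apply_eq hy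
  have hfr : ∀ y ∈ A, f (r (g y)) = f y := fun y hy => by
    have := h _ (hrA y hy) _ hy
    rw [hrg y hy, dist_self, mul_zero] at this
    exact dist_le_zero.1 this
  have hL : LipschitzOnWith C (f ∘ r) (g '' A) := by
    refine LipschitzOnWith.of_dist_le_mul ?_
    rintro _ ⟨y, hy, rfl⟩ _ ⟨z, hz, rfl⟩
    simpa [hrg y hy, hrg z hz] using h _ (hrA y hy) _ (hrA z hz)
  have himg : f '' A = (f ∘ r) '' (g '' A) := by
    rw [Set.image_image]
    exact Set.image_congr fun y hy => (hfr y hy).symm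
  have := hL.hausdorffMeasure_image_le (d := d) (by positivity)
  rw [himg]
  simp only [Measure.euclideanHausdorffMeasure_def, Measure.smul_apply, ENNReal.smul_def,
    smul_eq_mul]
  rw [mul_left_comm]
  gcongr
  simpa using this

/-- A local comparison of measures is a global one. -/
theorem Measure.le_smul_of_locally {X : Type*} [TopologicalSpace X] [SecondCountableTopology X]
    [MeasurableSpace X] [OpensMeasurableSpace X] {μ ν : Measure X} {K : ℝ≥0∞}
    (h : ∀ x, ∃ N ∈ 𝓝 x, ∀ A ⊆ N, MeasurableSet A → μ A ≤ K * ν A) : μ ≤ K • ν := by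
  choose N hN hle using h
  obtain ⟨s, hs, hcov⟩ := TopologicalSpace.countable_cover_nhds
    (f := fun x => interior (N x)) fun x => interior_mem_nhds.2 (hN x)
  rcases s.eq_empty_or_nonempty with rfl | hne
  · have : IsEmpty X := by
      rw [← Set.univ_eq_empty_iff, ← hcov]; simp
    rw [Measure.eq_zero_of_isEmpty μ]
    exact Measure.zero_le _
  obtain ⟨e, rfl⟩ := hs.exists_eq_range hne
  set U : ℕ → Set X := fun n => interior (N (e n))
  have hU : ∀ n, MeasurableSet (disjointed U n) :=
    fun n => MeasurableSet.disjointed (fun i => isOpen_interior.measurableSet) n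
  have hUu : ⋃ n, disjointed U n = Set.univ := by
    rw [iUnion_disjointed]; simpa [U] using hcov
  refine Measure.le_iff.2 fun A hA => ?_
  have hdec : ∀ ρ : Measure X, ρ A = ∑' n, ρ (A ∩ disjointed U n) := fun ρ => by
    rw [← measure_iUnion, ← Set.inter_iUnion, hUu, Set.inter_univ]
    · exact fun i j hij => (disjoint_disjointed U hij).mono Set.inter_subset_right
        Set.inter_subset_right
    · exact fun n => hA.inter (hU n)
  rw [Measure.smul_apply, hdec μ, hdec ν, smul_eq_mul, ← ENNReal.tsum_mul_left]
  refine ENNReal.tsum_le_tsum fun n => hle (e n) _ ?_ (hA.inter (hU n))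
  exact (Set.inter_subset_right.trans (disjointed_subset U n)).trans interior_subset

theorem Measure.le_of_forall_pow_smul {X : Type*} [MeasurableSpace X] {μ ν : Measure X} (d : ℕ)
    (h : ∀ C : ℝ≥0, 1 < C → μ ≤ ((C : ℝ≥0∞) ^ d) • ν) : μ ≤ ν := by
  refine Measure.le_iff.2 fun A _ => ?_
  by_cases hA : ν A = ∞
  · simp [hA]
  have hc : Tendsto (fun C : ℝ≥0 => ((C : ℝ≥0∞) ^ d) * ν A) (𝓝[>] 1) (𝓝 (((1 : ℝ≥0) : ℝ≥0∞) ^ d * ν A)) := by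
    refine Tendsto.mono_left ?_ nhdsWithin_le_nhds
    refine ENNReal.Tendsto.mul_const ?_ (Or.inr hA)
    exact ((ENNReal.continuous_pow d).comp ENNReal.continuous_coe).tendsto 1
  simp only [ENNReal.coe_one, one_pow, one_mul] at hc
  refine ge_of_tendsto hc ?_
  filter_upwards [self_mem_nhdsWithin] with C hC
  exact h C hC A

section AreaFormula

variable {U V : Type*} [NormedAddCommGroup U] [InnerProductSpace ℝ U] [FiniteDimensional ℝ U]
  [MeasurableSpace U] [BorelSpace U] [NormedAddCommGroup V] [InnerProductSpace ℝ V]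
  [MeasurableSpace V] [BorelSpace V]
  {γ : U → V} {γ' : U → U →L[ℝ] V}

/-- By strict differentiability, and because an injective linear map is antilipschitz, near `x` the
distances between images under `γ` and under its derivative agree up to the factor `C`. The measure
of a linear image is known exactly. -/
theorem exists_nhds_image_comparison {x : U} (hγ : HasStrictFDerivAt γ (γ' x) x)
    (hinj : Function.Injective (γ' x)) {C : ℝ≥0} (hC : 1 < C) :
    ∃ N ∈ 𝓝 x, ∀ A ⊆ N,
      (μHE[Module.finrank ℝ U] : Measure V) (γ '' A) ≤ (C : ℝ≥0∞) ^ Module.finrank ℝ U *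
        (ENNReal.ofReal (γ' x).toLinearMap.normDet * volume A) ∧
      ENNReal.ofReal (γ' x).toLinearMap.normDet * volume A ≤ (C : ℝ≥0∞) ^ Module.finrank ℝ U *
        (μHE[Module.finrank ℝ U] : Measure V) (γ '' A) := by
  set L := γ' x with hLdef
  obtain ⟨K, hK, hKL⟩ := (L : U →ₗ[ℝ] V).exists_antilipschitzWith
    (LinearMap.ker_eq_bot.2 hinj)
  have hC0 : 0 < C := zero_lt_one.trans hC
  have hC1 : (1 : ℝ) < C := hC
  have hCi : (0 : ℝ) < 1 - (C : ℝ)⁻¹ := sub_pos.2 (inv_lt_one_of_one_lt₀ hC1)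
  -- This choice gives `1 - ε = C⁻¹` and `1 + ε ≤ C`, as the two comparisons require.
  set ε : ℝ := 1 - (C : ℝ)⁻¹ with hε
  have hK' : (0 : ℝ) < K := hK
  have hbound := (hasStrictFDerivAt_iff_isLittleO.1 hγ).def (show (0 : ℝ) < ε / K by positivity)
  rw [nhds_prod_eq, eventually_prod_self_iff'] at hbound
  obtain ⟨N, hN, hNb⟩ := hbound
  have hLd : ∀ y z, dist y z ≤ K * dist (L y) (L z) := fun y z => hKL.le_mul_dist y z
  have key : ∀ y ∈ N, ∀ z ∈ N, ‖γ y - γ z - L (y - z)‖ ≤ ε * dist (L y) (L z) := by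
    intro y hy z hz
    refine (hNb y hy z hz).trans ?_
    have := hLd y z
    rw [dist_eq_norm] at this
    calc ε / K * ‖y - z‖ ≤ ε / K * (K * dist (L y) (L z)) := by gcongr
      _ = ε * dist (L y) (L z) := by field_simp
  refine ⟨N, hN, fun A hA => ?_⟩
  have hL := (L : U →ₗ[ℝ] V).euclideanHausdorffMeasure_image_eq_normDet_mul_volume A
  rw [← hL]
  constructor
  · refine euclideanHausdorffMeasure_image_le_of_dist_le _ fun y hy z hz => ?_
    have h1 := key y (hA hy) z (hA hz)
    have h2 : ‖γ y - γ z‖ ≤ ‖γ y - γ z - L (y - z)‖ + ‖L (y - z)‖ := by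
      simpa using norm_add_le (γ y - γ z - L (y - z)) (L (y - z))
    have h3 : dist (L y) (L z) = ‖L (y - z)‖ := by rw [dist_eq_norm, map_sub]
    have h4 : 1 + ε ≤ C := by
      rw [hε]
      have : (C : ℝ) * (C : ℝ)⁻¹ = 1 := mul_inv_cancel₀ (by positivity)
      nlinarith [sq_nonneg ((C : ℝ) - 1), inv_pos.2 (zero_lt_one.trans hC1)]
    rw [dist_eq_norm (γ y)]
    calc ‖γ y - γ z‖ ≤ (1 + ε) * dist (L y) (L z) := by linarith
      _ ≤ C * dist (L y) (L z) := by gcongr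
  · refine euclideanHausdorffMeasure_image_le_of_dist_le _ fun y hy z hz => ?_
    have h1 := key y (hA hy) z (hA hz)
    have h2 : ‖L (y - z)‖ ≤ ‖γ y - γ z - L (y - z)‖ + ‖γ y - γ z‖ := by
      have := norm_sub_le (γ y - γ z) (γ y - γ z - L (y - z))
      rw [sub_sub_cancel] at this
      linarith
    have h3 : dist (L y) (L z) = ‖L (y - z)‖ := by rw [dist_eq_norm, map_sub]
    have h5 : (C : ℝ)⁻¹ * dist (L y) (L z) ≤ dist (γ y) (γ z) := by
      rw [dist_eq_norm (γ y)]
      rw [hε] at h1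
      linarith
    rw [inv_mul_le_iff₀ (by positivity)] at h5
    exact h5

/-- **Area formula** for an injective `C¹` immersion. -/
theorem lintegral_range_euclideanHausdorffMeasure (hγ : ∀ x, HasStrictFDerivAt γ (γ' x) x)
    (hcont : Continuous fun x => (γ' x).toLinearMap.normDet)
    (hinj : ∀ x, Function.Injective (γ' x)) (hemb : MeasurableEmbedding γ) (F : V → ℝ≥0∞) :
    ∫⁻ y in Set.range γ, F y ∂(μHE[Module.finrank ℝ U] : Measure V) =
      ∫⁻ x, ENNReal.ofReal (γ' x).toLinearMap.normDet * F (γ x) := by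
  set J : U → ℝ := fun x => (γ' x).toLinearMap.normDet with hJ
  have hJpos : ∀ x, 0 < J x := fun x =>
    lt_of_le_of_ne (LinearMap.normDet_nonneg _)
      fun h => LinearMap.normDet_eq_zero_iff_ker_ne_bot.1 h.symm (LinearMap.ker_eq_bot.2 (hinj x))
  set d := Module.finrank ℝ U
  set ν : Measure U := (μHE[d] : Measure V).comap γ with hν
  set μ : Measure U := volume.withDensity fun x => ENNReal.ofReal (J x) with hμ
  have hνA : ∀ A, MeasurableSet A → ν A = (μHE[d] : Measure V) (γ '' A) :=
    fun A _ => hemb.comap_apply _ A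
  have hJC : ∀ x, ∀ C : ℝ≥0, 1 < C → ∀ᶠ y in 𝓝 x, J y ≤ C * J x ∧ J x ≤ C * J y := by
    intro x C hC
    have hC1 : (1 : ℝ) < C := hC
    have h1 : ∀ᶠ y in 𝓝 x, J y < C * J x :=
      hcont.continuousAt.eventually_lt continuousAt_const (by nlinarith [hJpos x])
    have h2 : ∀ᶠ y in 𝓝 x, J x < C * J y :=
      continuousAt_const.eventually_lt (hcont.const_mul _).continuousAt
        (by nlinarith [hJpos x])
    filter_upwards [h1, h2] with y h1 h2 using ⟨h1.le, h2.le⟩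
  -- Of the `d + 1` factors `C`, `d` come from the comparison of distances and one from the
  -- oscillation of `J`. Letting `C ↓ 1` afterwards gives equality of the measures.
  have hloc : ∀ C : ℝ≥0, 1 < C → ∀ x, ∃ N ∈ 𝓝 x, ∀ A ⊆ N, MeasurableSet A →
      ν A ≤ (C : ℝ≥0∞) ^ (d + 1) * μ A ∧ μ A ≤ (C : ℝ≥0∞) ^ (d + 1) * ν A := by
    intro C hC x
    obtain ⟨N, hN, hNle⟩ := exists_nhds_image_comparison (hγ x) (hinj x) hC
    obtain ⟨M, hM, hMle⟩ := eventually_iff_exists_mem.1 (hJC x C hC)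
    refine ⟨N ∩ M, inter_mem hN hM, fun A hA hAm => ?_⟩
    obtain ⟨h1, h2⟩ := hNle A (hA.trans Set.inter_subset_left)
    have hμA : μ A = ∫⁻ y in A, ENNReal.ofReal (J y) := withDensity_apply _ hAm
    have h3 : ENNReal.ofReal (J x) * volume A ≤ C * μ A := by
      rw [hμA, ← lintegral_const_mul' _ _ ENNReal.coe_ne_top, ← setLIntegral_const]
      refine setLIntegral_mono' hAm fun y hy => ?_
      rw [← ENNReal.ofReal_coe_nnreal, ← ENNReal.ofReal_mul C.coe_nonneg]
      exact ENNReal.ofReal_le_ofReal (hMle y (hA hy).2).2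
    have h4 : μ A ≤ C * (ENNReal.ofReal (J x) * volume A) := by
      rw [hμA, ← mul_assoc, ← setLIntegral_const]
      refine setLIntegral_mono' hAm fun y hy => ?_
      rw [← ENNReal.ofReal_coe_nnreal, ← ENNReal.ofReal_mul C.coe_nonneg]
      exact ENNReal.ofReal_le_ofReal (hMle y (hA hy).2).1
    rw [hνA A hAm, pow_succ, mul_assoc]
    refine ⟨h1.trans (by gcongr), h4.trans ?_⟩
    rw [mul_right_comm, mul_comm]
    gcongr
  have hνμ : ν = μ := le_antisymm
    (Measure.le_of_forall_pow_smul (d + 1) fun C hC => Measure.le_smul_of_locally fun x =>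
      let ⟨N, hN, h⟩ := hloc C hC x; ⟨N, hN, fun A hA hAm => (h A hA hAm).1⟩)
    (Measure.le_of_forall_pow_smul (d + 1) fun C hC => Measure.le_smul_of_locally fun x =>
      let ⟨N, hN, h⟩ := hloc C hC x; ⟨N, hN, fun A hA hAm => (h A hA hAm).2⟩)
  rw [← hemb.map_comap, hemb.lintegral_map, ← hν, hνμ, hμ,
    lintegral_withDensity_eq_lintegral_mul_non_measurable _ hcont.measurable.ennreal_ofReal
      (ae_of_all _ fun _ => ENNReal.ofReal_lt_top)]
  rfl

end AreaFormula

end MeasureTheory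

namespace RelBoltz

open scoped RealInnerProductSpace

/-- The plane carrying the parameters of the collision surfaces. -/
abbrev E2 : Type := EuclideanSpace ℝ (Fin 2)

/-! ### Elementary estimates for the energy. -/

section Energy

theorem energy_sq (p : E3) : energy p ^ 2 = 1 + ‖p‖ ^ 2 := Real.sq_sqrt (by positivity)

theorem one_le_energy (p : E3) : 1 ≤ energy p := Real.one_le_sqrt.2 (by nlinarith [sq_nonneg ‖p‖])

theorem energy_pos (p : E3) : 0 < energy p := one_pos.trans_le (one_le_energy p)

theorem norm_lt_energy (p : E3) : ‖p‖ < energy p :=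
  Real.lt_sqrt_of_sq_lt (by linarith)

theorem energy_le (p : E3) : energy p ≤ 1 + ‖p‖ :=
  Real.sqrt_le_iff.2 ⟨by positivity, by nlinarith [norm_nonneg p]⟩

theorem continuous_energy : Continuous energy := by
  unfold energy; fun_prop

theorem energy_eq_of_sq {p : E3} {e : ℝ} (he : 0 ≤ e) (h : e ^ 2 = 1 + ‖p‖ ^ 2) :
    energy p = e := by
  rw [energy, ← h, Real.sqrt_sq he]

theorem continuous_fourMom : Continuous fourMom := by
  refine continuous_pi fun i => ?_
  refine Fin.cases ?_ (fun j => ?_) i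
  · simpa [fourMom] using continuous_energy
  · simp only [fourMom, Fin.cons_succ]
    fun_prop

/-- A quantitative form of the bound `|E(p') - E(p)| < |p' - p|`. -/
theorem mul_le_norm_sub_sub_abs (p p' : E3) :
    ‖p' - p‖ * ((energy p - ‖p‖) / (energy p + energy p')) ≤
      ‖p' - p‖ - |energy p' - energy p| := by
  have hs : 0 < energy p + energy p' := add_pos (energy_pos p) (energy_pos p')
  -- Both sides are `|E(p')² - E(p)²|` in factored form. The strictness comes from `‖p'‖ < E(p')`.
  have h1 : |energy p' - energy p| * (energy p + energy p') = |‖p'‖ - ‖p‖| * (‖p'‖ + ‖p‖) := by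
    rw [← abs_of_pos hs, ← abs_mul, ← abs_of_nonneg (by positivity : 0 ≤ ‖p'‖ + ‖p‖), ← abs_mul]
    congr 1
    nlinarith [energy_sq p, energy_sq p']
  have h2 : |‖p'‖ - ‖p‖| ≤ ‖p' - p‖ := abs_norm_sub_norm_le _ _
  rw [← mul_div_assoc, div_le_iff₀ hs, sub_mul, h1]
  have h3 := norm_lt_energy p'
  have h4 : |‖p'‖ - ‖p‖| * (‖p'‖ + ‖p‖) ≤ ‖p' - p‖ * (‖p'‖ + ‖p‖) := by gcongr
  nlinarith [norm_nonneg (p' - p)]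

theorem abs_energy_sub_le (p p' : E3) : |energy p' - energy p| ≤ ‖p' - p‖ := by
  have := mul_le_norm_sub_sub_abs p p'
  have h : 0 ≤ ‖p' - p‖ * ((energy p - ‖p‖) / (energy p + energy p')) :=
    mul_nonneg (norm_nonneg _) (div_nonneg (by linarith [norm_lt_energy p])
      (add_pos (energy_pos p) (energy_pos p')).le)
  linarith

theorem abs_energy_sub_lt {p p' : E3} (h : p' ≠ p) : |energy p' - energy p| < ‖p' - p‖ := by
  have := mul_le_norm_sub_sub_abs p p'
  have h : 0 < ‖p' - p‖ * ((energy p - ‖p‖) / (energy p + energy p')) :=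
    mul_pos (norm_pos_iff.2 (sub_ne_zero.2 h)) (div_pos (by linarith [norm_lt_energy p])
      (add_pos (energy_pos p) (energy_pos p')))
  linarith

theorem hasFDerivAt_energy (p : E3) :
    HasFDerivAt energy ((energy p)⁻¹ • innerSL ℝ p) p := by
  have h := ((hasStrictFDerivAt_norm_sq p).hasFDerivAt.const_add 1).sqrt
    (by positivity : (1 + ‖p‖ ^ 2 : ℝ) ≠ 0)
  convert! h using 1
  ext v
  simp [energy]
  ring

end Energy

/-! ### The collision surface and conservation of energy. -/

section Conservation

/-- The defining function of the collision surface. -/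
noncomputable def layer (p p' q' : E3) : ℝ :=
  ⟪p' - p, q' - p⟫ - (energy p' - energy p) * (energy q' - energy p)

theorem inner_eq_sum (x y : E3) : ⟪x, y⟫ = ∑ i, x i * y i := by
  rw [PiLp.inner_apply]
  exact Finset.sum_congr rfl fun i _ => by simp [mul_comm]

theorem lorentz_sub_sub (p p' q' : E3) :
    lorentz (fourMom p' - fourMom p) (fourMom q' - fourMom p) = layer p p' q' := by
  simp only [lorentz, layer, inner_eq_sum, fourMom, Pi.sub_apply, Fin.cons_zero, Fin.cons_succ,
    PiLp.sub_apply]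
  ring

theorem mem_collSurface {p p' q' : E3} : q' ∈ collSurface p p' ↔ layer p p' q' = 0 := by
  rw [collSurface, Set.mem_ofPred_eq, lorentz_sub_sub]

/-- A difference of squares, expanded by the mass-shell relation. It turns a small energy defect
into a small value of `layer`, and makes a zero of `layer` mean energy conservation up to the sign
of the root. -/
theorem energy_mul_eq_two_mul_layer (p p' q' : E3) :
    (energy (p' + q' - p) + (energy p' + energy q' - energy p)) *
      (energy (p' + q' - p) - (energy p' + energy q' - energy p)) = 2 * layer p p' q' := by
  have h1 := energy_sq (p' + q' - p)
  have h2 := energy_sq p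
  have h3 := energy_sq p'
  have h4 := energy_sq q'
  have h5 : ‖p' + q' - p‖ ^ 2 = ‖p'‖ ^ 2 + ‖q'‖ ^ 2 + ‖p‖ ^ 2 + 2 * ⟪p', q'⟫ - 2 * ⟪p', p⟫
      - 2 * ⟪q', p⟫ := by
    rw [norm_sub_sq_real, norm_add_sq_real, inner_add_left]; ring
  have h6 : layer p p' q' = ⟪p', q'⟫ - ⟪p', p⟫ - ⟪q', p⟫ + ‖p‖ ^ 2
      - (energy p' - energy p) * (energy q' - energy p) := by
    rw [layer, inner_sub_left, inner_sub_right, inner_sub_right, real_inner_self_eq_norm_sq,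
      real_inner_comm q' p]
    ring
  rw [h6]
  linear_combination h1 + h5 - h3 - h4 + h2

theorem energy_mul_energy_gt (p q : E3) : ⟪p, q⟫ < energy p * energy q :=
  (real_inner_le_norm p q).trans_lt
    (mul_lt_mul'' (norm_lt_energy p) (norm_lt_energy q) (norm_nonneg _) (norm_nonneg _))

/-- On the collision surface `p'⁰ + q'⁰ - p⁰` is the energy of `p' + q' - p`. -/
theorem energy_eq_of_layer_eq_zero {p p' q' : E3} (h : layer p p' q' = 0) :
    energy (p' + q' - p) = energy p' + energy q' - energy p := by
  have h0 := energy_mul_eq_two_mul_layer p p' q'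
  rw [h, mul_zero, mul_eq_zero] at h0
  rcases h0 with h0 | h0
  -- The root of the wrong sign is impossible: the strict inequality of `energy_mul_energy_gt`, for
  -- the pairs `(p, q')` and `(-q, p')` with `q = p' + q' - p`, contradicts `layer = 0`.
  · exfalso
    have h1 := energy_mul_energy_gt p q'
    have h2 := energy_mul_energy_gt (-(p' + q' - p)) p'
    have h3 : ⟪-(p' + q' - p), p'⟫ = -‖p'‖ ^ 2 - ⟪p', q'⟫ + ⟪p', p⟫ := by
      rw [inner_neg_left, inner_sub_left, inner_add_left, real_inner_self_eq_norm_sq,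
        real_inner_comm, real_inner_comm p' p]
      ring
    have h4 : energy (-(p' + q' - p)) = energy (p' + q' - p) := by
      rw [energy, energy, norm_neg]
    have h6 : layer p p' q' = ⟪p', q'⟫ - ⟪p', p⟫ - ⟪p, q'⟫ + ‖p‖ ^ 2
        - (energy p' - energy p) * (energy q' - energy p) := by
      rw [layer, inner_sub_left, inner_sub_right, inner_sub_right, real_inner_self_eq_norm_sq]
      ring
    rw [h4, h3, show energy (p' + q' - p) = -(energy p' + energy q' - energy p) by linarith] at h2
    nlinarith [energy_sq p, energy_sq p']
  · linarith

end Conservation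

/-! ### Cylindrical coordinates about a given axis. -/

section Frame

/-- `(w, z) ↦ (w₀, w₁, z)`. -/
noncomputable def cyl : E2 × ℝ →L[ℝ] E3 :=
  LinearMap.toContinuousLinearMap
    { toFun := fun x => WithLp.toLp 2 ![x.1 0, x.1 1, x.2]
      map_add' := fun x y => by ext i; fin_cases i <;> simp
      map_smul' := fun c x => by ext i; fin_cases i <;> simp }

@[simp] theorem cyl_zero (x : E2 × ℝ) : cyl x 0 = x.1 0 := rfl
@[simp] theorem cyl_one (x : E2 × ℝ) : cyl x 1 = x.1 1 := rfl
@[simp] theorem cyl_two (x : E2 × ℝ) : cyl x 2 = x.2 := rfl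

theorem inner_cyl (x y : E2 × ℝ) : ⟪cyl x, cyl y⟫ = ⟪x.1, y.1⟫ + x.2 * y.2 := by
  simp [PiLp.inner_apply, Fin.sum_univ_three, mul_comm]

theorem norm_cyl_sq (x : E2 × ℝ) : ‖cyl x‖ ^ 2 = ‖x.1‖ ^ 2 + x.2 ^ 2 := by
  rw [← real_inner_self_eq_norm_sq, inner_cyl, real_inner_self_eq_norm_sq]; ring

theorem exists_cyl_eq (v : E3) : ∃ x, cyl x = v :=
  ⟨(WithLp.toLp 2 ![v 0, v 1], v 2), by ext i; fin_cases i <;> simp⟩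

theorem measurePreserving_cyl : MeasurePreserving cyl (volume : Measure (E2 × ℝ)) volume := by
  have h1 := (EuclideanSpace.volume_preserving_symm_measurableEquiv_toLp (Fin 2)).prod
    (MeasurePreserving.id (volume : Measure ℝ))
  have h2 := Measure.measurePreserving_swap (μ := (volume : Measure (Fin 2 → ℝ)))
    (ν := (volume : Measure ℝ))
  have h3 := (volume_preserving_piFinSuccAbove (fun _ : Fin 3 => ℝ) (Fin.last 2)).symm
  have h4 := (EuclideanSpace.volume_preserving_symm_measurableEquiv_toLp (Fin 3)).symm
  convert! h4.comp (h3.comp (h2.comp h1)) using 1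
  ext x i
  fin_cases i <;> rfl

/-- The third coordinate axis. -/
noncomputable def axis : E3 := EuclideanSpace.single 2 1

theorem norm_axis : ‖axis‖ = 1 := by simp [axis]

/-- A reflection that sends the third axis to the direction of `a`. -/
noncomputable def frame (a : E3) : E3 ≃ₗᵢ[ℝ] E3 :=
  Submodule.reflection (Submodule.span ℝ {axis - ‖a‖⁻¹ • a})ᗮ

/-- The explicit formula yields joint measurability in the axis and the point. It is also valid when
`a` already points along `axis`: the reflecting vector is then zero and the frame is the identity.
-/
theorem frame_apply (a x : E3) : frame a x =
    x - (2 * (⟪axis - ‖a‖⁻¹ • a, x⟫ / ‖axis - ‖a‖⁻¹ • a‖ ^ 2)) • (axis - ‖a‖⁻¹ • a) := by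
  rw [frame, Submodule.reflection_orthogonal_apply, Submodule.reflection_singleton_apply,
    neg_sub, ← Nat.cast_smul_eq_nsmul ℝ, smul_smul]
  norm_num

theorem frame_axis {a : E3} (ha : a ≠ 0) : frame a axis = ‖a‖⁻¹ • a := by
  refine Submodule.reflection_sub ?_
  rw [norm_axis, norm_smul, norm_inv, norm_norm, inv_mul_cancel₀ (norm_ne_zero_iff.2 ha)]

theorem inner_frame_cyl {a : E3} (ha : a ≠ 0) (x : E2 × ℝ) : ⟪a, frame a (cyl x)⟫ = ‖a‖ * x.2 := by
  have h : a = ‖a‖ • frame a axis := by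
    rw [frame_axis ha, smul_smul, mul_inv_cancel₀ (norm_ne_zero_iff.2 ha), one_smul]
  conv_lhs => rw [h]
  rw [show frame (‖a‖ • frame a axis) = frame a by rw [← h], real_inner_smul_left,
    LinearIsometryEquiv.inner_map_map]
  simp [axis, EuclideanSpace.inner_single_left]

theorem measurable_frame : Measurable fun x : E3 × E3 => frame x.1 x.2 := by
  simp only [frame_apply]
  fun_prop

end Frame

/-! ### The collision surface as a graph and its surface measure. -/

section Graph

/-- With `A = |p' - p|`, `a` the gap, `B` the offset and `M = |w|²`, this solves `A z + B = a e`,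
`e² = 1 + M + z²` for the height `z` and the energy `e`. The sign of the square root `S` is fixed by
`e > 0`, which follows from `|B| < S`. The last identity gives the `z`-derivative `A - a z / e = S /
e` of `layer`. -/
theorem graph_identities {A a B M S : ℝ} (hA : |a| < A) (hM : 0 ≤ M) (hS : 0 ≤ S)
    (hS2 : S ^ 2 = B ^ 2 + (A ^ 2 - a ^ 2) * (1 + M)) :
    0 < S ∧ 0 < (A * S - a * B) / (A ^ 2 - a ^ 2) ∧
    ((A * S - a * B) / (A ^ 2 - a ^ 2)) ^ 2 = 1 + (M + ((a * S - A * B) / (A ^ 2 - a ^ 2)) ^ 2) ∧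
    A * ((a * S - A * B) / (A ^ 2 - a ^ 2)) + B = a * ((A * S - a * B) / (A ^ 2 - a ^ 2)) ∧
    A * ((A * S - a * B) / (A ^ 2 - a ^ 2)) - a * ((a * S - A * B) / (A ^ 2 - a ^ 2)) = S := by
  have hA0 : 0 < A := (abs_nonneg a).trans_lt hA
  have hD : 0 < A ^ 2 - a ^ 2 := by nlinarith [sq_abs a, abs_nonneg a]
  have hSB : |B| < S := abs_lt_of_sq_lt_sq (by nlinarith) hS
  have hS0 : 0 < S := (abs_nonneg B).trans_lt hSB
  refine ⟨hS0, div_pos ?_ hD, ?_, ?_, ?_⟩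
  · have h1 : a * B ≤ |a| * |B| := by rw [← abs_mul]; exact le_abs_self _
    have h2 : |a| * |B| ≤ |a| * S := mul_le_mul_of_nonneg_left hSB.le (abs_nonneg a)
    nlinarith
  · field_simp
    linear_combination (A ^ 2 - a ^ 2) * hS2
  · field_simp
    ring
  · field_simp
    ring

/-- The gap `p'⁰ - p⁰`. -/
noncomputable def gap (p p' : E3) : ℝ := energy p' - energy p

/-- The offset of the collision surface. -/
noncomputable def offset (p p' : E3) : ℝ := gap p p' * energy p - ⟪p' - p, p⟫

/-- The square root in the explicit solution of the equation of the collision surface. -/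
noncomputable def root (p p' : E3) (w : E2) : ℝ :=
  Real.sqrt (offset p p' ^ 2 + (‖p' - p‖ ^ 2 - gap p p' ^ 2) * (1 + ‖w‖ ^ 2))

/-- The height of the collision surface over the plane orthogonal to `p' - p`. -/
noncomputable def height (p p' : E3) (w : E2) : ℝ :=
  (gap p p' * root p p' w - ‖p' - p‖ * offset p p') / (‖p' - p‖ ^ 2 - gap p p' ^ 2)

/-- The point with cylindrical coordinates `(w, z)` about the axis `p' - p`. -/
noncomputable def pt (p p' : E3) (x : E2 × ℝ) : E3 := frame (p' - p) (cyl x)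

/-- The parametrization of the collision surface. -/
noncomputable def surf (p p' : E3) (w : E2) : E3 := pt p p' (w, height p p' w)

variable {p p' : E3}

theorem norm_pt_sq (x : E2 × ℝ) : ‖pt p p' x‖ ^ 2 = ‖x.1‖ ^ 2 + x.2 ^ 2 := by
  rw [pt, LinearIsometryEquiv.norm_map, norm_cyl_sq]

theorem layer_pt (h : p' ≠ p) (x : E2 × ℝ) :
    layer p p' (pt p p' x) = ‖p' - p‖ * x.2 + offset p p' - gap p p' * energy (pt p p' x) := by
  rw [layer, inner_sub_right, pt, inner_frame_cyl (sub_ne_zero.2 h), offset, gap]; ring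

theorem sq_gap_lt (h : p' ≠ p) : 0 < ‖p' - p‖ ^ 2 - gap p p' ^ 2 := by
  have := abs_energy_sub_lt h
  have h0 := abs_nonneg (energy p' - energy p)
  rw [gap, ← sq_abs (energy p' - energy p)]
  nlinarith

theorem root_sq (h : p' ≠ p) (w : E2) : root p p' w ^ 2 =
    offset p p' ^ 2 + (‖p' - p‖ ^ 2 - gap p p' ^ 2) * (1 + ‖w‖ ^ 2) :=
  Real.sq_sqrt (by have := sq_gap_lt h; positivity)

theorem surf_identities (h : p' ≠ p) (w : E2) :
    0 < root p p' w ∧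
    ‖p' - p‖ * height p p' w + offset p p' = gap p p' * energy (surf p p' w) ∧
    ‖p' - p‖ * energy (surf p p' w) - gap p p' * height p p' w = root p p' w := by
  obtain ⟨h1, h2, h3, h4, h5⟩ := graph_identities (abs_energy_sub_lt h) (sq_nonneg ‖w‖)
    (Real.sqrt_nonneg _) (root_sq h w)
  have hE : energy (surf p p' w) = _ := energy_eq_of_sq h2.le
    (by rw [surf, norm_pt_sq]; exact h3)
  rw [hE]
  exact ⟨h1, h4, h5⟩

theorem layer_surf (h : p' ≠ p) (w : E2) : layer p p' (surf p p' w) = 0 := by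
  have := (surf_identities h w).2.1
  rw [surf] at this ⊢
  rw [layer_pt h, this, sub_self]

/-- The layer function grows at least linearly away from the collision surface. -/
theorem le_abs_layer_pt (h : p' ≠ p) (w : E2) (t : ℝ) :
    (‖p' - p‖ - |gap p p'|) * |t| ≤ |layer p p' (pt p p' (w, height p p' w + t))| := by
  have h1 := layer_pt h (w, height p p' w + t)
  have h2 := layer_pt h (w, height p p' w)
  have h0 : layer p p' (pt p p' (w, height p p' w)) = 0 := layer_surf h w
  rw [h0] at h2
  have h3 : ‖pt p p' (w, height p p' w + t) - pt p p' (w, height p p' w)‖ = |t| := by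
    rw [pt, pt, ← map_sub, ← map_sub, LinearIsometryEquiv.norm_map]
    have := norm_cyl_sq ((w, height p p' w + t) - (w, height p p' w))
    simp only [Prod.mk_sub_mk, sub_self, norm_zero, add_sub_cancel_left] at this ⊢
    rw [← abs_norm, ← sq_eq_sq_iff_abs_eq_abs, this]; ring
  have h4 := abs_energy_sub_le (pt p p' (w, height p p' w)) (pt p p' (w, height p p' w + t))
  rw [h3] at h4
  set e := energy (pt p p' (w, height p p' w + t)) - energy (pt p p' (w, height p p' w)) with he
  have h5 : layer p p' (pt p p' (w, height p p' w + t)) = ‖p' - p‖ * t - gap p p' * e := by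
    rw [h1, he]; simp only at h2 ⊢; linarith
  rw [h5]
  have h6 := abs_sub_abs_le_abs_sub (‖p' - p‖ * t) (gap p p' * e)
  rw [abs_mul, abs_mul, abs_norm] at h6
  have h7 : |gap p p'| * |e| ≤ |gap p p'| * |t| := by gcongr
  linarith

/-- Uniqueness of the zero on each line parallel to the axis comes from `le_abs_layer_pt`. -/
theorem range_surf (h : p' ≠ p) : Set.range (surf p p') = collSurface p p' := by
  ext q'
  rw [mem_collSurface]
  constructor
  · rintro ⟨w, rfl⟩
    exact layer_surf h w
  · intro hq
    obtain ⟨⟨w, z⟩, hx⟩ := exists_cyl_eq ((frame (p' - p)).symm q')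
    have hx' : pt p p' (w, z) = q' := by rw [pt, hx, LinearIsometryEquiv.apply_symm_apply]
    have := le_abs_layer_pt h w (z - height p p' w)
    rw [add_sub_cancel, hx', hq, abs_zero] at this
    have h1 : 0 < ‖p' - p‖ - |gap p p'| := sub_pos.2 (abs_energy_sub_lt h)
    have h2 : |z - height p p' w| ≤ 0 := nonpos_of_mul_nonpos_right this h1
    rw [abs_nonpos_iff, sub_eq_zero] at h2
    exact ⟨w, by rw [surf, ← h2, hx']⟩

/-- The derivative of the parametrization of the collision surface. -/
noncomputable def surfDeriv (p p' : E3) (w : E2) : E2 →L[ℝ] E3 :=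
  (frame (p' - p) : E3 →L[ℝ] E3) ∘L cyl ∘L
    (ContinuousLinearMap.id ℝ E2).prod ((gap p p' / root p p' w) • innerSL ℝ w)

theorem hasStrictFDerivAt_surf (h : p' ≠ p) (w : E2) :
    HasStrictFDerivAt (surf p p') (surfDeriv p p' w) w := by
  have hD := sq_gap_lt h
  have hr : HasStrictFDerivAt (root p p')
      (((‖p' - p‖ ^ 2 - gap p p' ^ 2) / root p p' w) • innerSL ℝ w) w := by
    have h1 := ((((hasStrictFDerivAt_norm_sq w).const_add 1).const_mul
      (‖p' - p‖ ^ 2 - gap p p' ^ 2)).const_add (offset p p' ^ 2)).sqrt (by positivity)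
    convert! h1 using 1
    ext v
    simp [root]
    ring
  have hh : HasStrictFDerivAt (height p p') ((gap p p' / root p p' w) • innerSL ℝ w) w := by
    have h1 := ((hr.const_mul (gap p p')).sub_const (‖p' - p‖ * offset p p')).mul_const
      (‖p' - p‖ ^ 2 - gap p p' ^ 2)⁻¹
    convert! h1 using 1
    ext v
    simp
    field_simp
  exact (frame (p' - p) : E3 →L[ℝ] E3).hasStrictFDerivAt.comp w
    (cyl.hasStrictFDerivAt.comp w ((hasStrictFDerivAt_id w).prodMk hh))

theorem inner_surfDeriv (w v v' : E2) : ⟪surfDeriv p p' w v, surfDeriv p p' w v'⟫ =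
    ⟪v, v'⟫ + (gap p p' / root p p' w * ⟪w, v⟫) * (gap p p' / root p p' w * ⟪w, v'⟫) := by
  have := (frame (p' - p)).inner_map_map
    (cyl (v, gap p p' / root p p' w * ⟪w, v⟫)) (cyl (v', gap p p' / root p p' w * ⟪w, v'⟫))
  rw [inner_cyl] at this
  exact this

theorem surfDeriv_injective (w : E2) : Function.Injective (surfDeriv p p' w) := by
  refine (injective_iff_map_eq_zero _).2 fun v hv => ?_
  have := inner_surfDeriv (p := p) (p' := p') w v v
  rw [hv, inner_zero_left, real_inner_self_eq_norm_sq] at this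
  have h0 : ‖v‖ ^ 2 ≤ 0 := by nlinarith [mul_self_nonneg (gap p p' / root p p' w * ⟪w, v⟫)]
  exact norm_eq_zero.1 (pow_eq_zero_iff (two_ne_zero)|>.1 (le_antisymm h0 (sq_nonneg _)))

/-- The Gram matrix is the identity plus the rank-one matrix of `∇height = (gap / root) w`. -/
theorem normDet_surfDeriv (w : E2) : (surfDeriv p p' w).toLinearMap.normDet =
    Real.sqrt (1 + (gap p p' / root p p' w) ^ 2 * ‖w‖ ^ 2) := by
  have h := LinearMap.normDet_sq_eq_det_gram (surfDeriv p p' w).toLinearMap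
    (EuclideanSpace.basisFun (Fin 2) ℝ)
  rw [Matrix.det_fin_two] at h
  simp only [Matrix.gram_apply, ContinuousLinearMap.coe_coe, inner_surfDeriv] at h
  simp [EuclideanSpace.inner_single_right] at h
  rw [EuclideanSpace.norm_sq_eq, Fin.sum_univ_two, ← Real.sqrt_sq (LinearMap.normDet_nonneg _), h]
  congr 1
  simp
  ring

/-- The left side is `|∇layer|`. On a level set that is a graph, it equals `|∂_z layer| √(1 +
|∇height|²)`, and here `∂_z layer = root / q'⁰`. -/
theorem layerDenom_surf (h : p' ≠ p) (w : E2) : layerDenom p p' (surf p p' w) =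
    root p p' w / energy (surf p p' w) *
      Real.sqrt (1 + (gap p p' / root p p' w) ^ 2 * ‖w‖ ^ 2) := by
  obtain ⟨hr, -, h2⟩ := surf_identities h w
  have hE := energy_pos (surf p p' w)
  have hsq : layerDenom p p' (surf p p' w) ^ 2 =
      (root p p' w / energy (surf p p' w)) ^ 2 *
        (1 + (gap p p' / root p p' w) ^ 2 * ‖w‖ ^ 2) := by
    rw [layerDenom, norm_sub_sq_real, norm_smul, mul_pow, real_inner_smul_left, real_inner_comm,
      surf, norm_pt_sq, Real.norm_eq_abs, sq_abs, pt, inner_frame_cyl (sub_ne_zero.2 h),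
      ← pt, ← surf, ← gap]
    field_simp
    linear_combination (‖p' - p‖ * energy (surf p p' w) - gap p p' * height p p' w +
      root p p' w) * h2
  rw [← Real.sqrt_sq (show 0 ≤ layerDenom p p' (surf p p' w) from norm_nonneg _), hsq,
    Real.sqrt_mul (sq_nonneg _), Real.sqrt_sq (by positivity)]

theorem continuous_surf (h : p' ≠ p) : Continuous (surf p p') :=
  continuous_iff_continuousAt.2 fun w => (hasStrictFDerivAt_surf h w).continuousAt

theorem surf_injective : Function.Injective (surf p p') := by
  intro w w' hw
  have h1 : cyl (w, height p p' w) = cyl (w', height p p' w') :=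
    (frame (p' - p)).injective hw
  ext i
  fin_cases i
  · exact congrArg (fun x : E3 => x 0) h1
  · exact congrArg (fun x : E3 => x 1) h1

/-- Integration over the collision surface. -/
theorem lintegral_collSurface (h : p' ≠ p) (F : E3 → ℝ≥0∞) :
    ∫⁻ q' in collSurface p p', F q' ∂(μHE[2] : Measure E3) =
      ∫⁻ w, ENNReal.ofReal (Real.sqrt (1 + (gap p p' / root p p' w) ^ 2 * ‖w‖ ^ 2)) *
        F (surf p p' w) := by
  have hc : Continuous fun w => (surfDeriv p p' w).toLinearMap.normDet := by
    simp only [normDet_surfDeriv]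
    have hr : ∀ w, root p p' w ≠ 0 := fun w => (surf_identities h w).1.ne'
    have hrc : Continuous (root p p') := by unfold root; fun_prop
    fun_prop (disch := assumption)
  have := lintegral_range_euclideanHausdorffMeasure (hasStrictFDerivAt_surf h) hc
    surfDeriv_injective ((continuous_surf h).measurableEmbedding surf_injective) F
  rw [finrank_euclideanSpace_fin, range_surf h] at this
  simpa only [normDet_surfDeriv] using this

end Graph

end RelBoltz

namespace RelBoltz

open scoped RealInnerProductSpace

/-- A family of volume preserving maps, as a map of the product. -/
theorem measurePreserving_family {α β γ : Type*} [MeasureSpace α] [MeasureSpace β] [MeasureSpace γ]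
    [SFinite (volume : Measure α)] [SFinite (volume : Measure β)] {g : α → β → γ}
    (hm : Measurable fun y : α × β => g y.1 y.2)
    (h : ∀ a, MeasurePreserving (g a) volume volume) :
    MeasurePreserving (fun y : α × β => (y.1, g y.1 y.2)) volume volume :=
  (MeasurePreserving.id volume).skew_product hm (ae_of_all _ fun a => (h a).map_eq)

/-! ### A volume preserving chart adapted to the conservation laws. -/

section Chart

variable (p : E3)

/-- Coordinates on the space of `(q, q', p')`: the momentum `p'`, the cylindrical coordinates `w`
and `z` of `q'` about the axis `p' - p`, with `z` counted from the collision surface, and the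
defect `u` in the conservation of momentum. -/
noncomputable def chart (y : (E3 × E2) × (ℝ × E3)) : E3 × E3 × E3 :=
  (y.1.1 + pt p y.1.1 (y.1.2, height p y.1.1 y.1.2 + y.2.1) - p + y.2.2,
    pt p y.1.1 (y.1.2, height p y.1.1 y.1.2 + y.2.1), y.1.1)

theorem measurable_energy : Measurable energy := continuous_energy.measurable

theorem measurable_gap : Measurable fun p' : E3 => gap p p' :=
  measurable_energy.sub_const _

theorem measurable_offset : Measurable fun p' : E3 => offset p p' :=
  ((measurable_gap p).mul_const _).sub ((measurable_id.sub_const p).inner measurable_const)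

theorem measurable_norm_sub : Measurable fun p' : E3 => ‖p' - p‖ :=
  (measurable_id.sub_const p).norm

theorem measurable_root : Measurable fun x : E3 × E2 => root p x.1 x.2 :=
  Measurable.sqrt (((measurable_offset p).comp measurable_fst).pow_const 2 |>.add
    (((((measurable_norm_sub p).comp measurable_fst).pow_const 2).sub
      (((measurable_gap p).comp measurable_fst).pow_const 2)).mul
        ((measurable_snd.norm.pow_const 2).const_add 1)))

theorem measurable_height : Measurable fun x : E3 × E2 => height p x.1 x.2 :=
  ((((measurable_gap p).comp measurable_fst).mul (measurable_root p)).sub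
    (((measurable_norm_sub p).comp measurable_fst).mul
      ((measurable_offset p).comp measurable_fst))).div
    ((((measurable_norm_sub p).comp measurable_fst).pow_const 2).sub
      (((measurable_gap p).comp measurable_fst).pow_const 2))

theorem measurable_pt : Measurable fun x : E3 × (E2 × ℝ) => pt p x.1 x.2 := by
  change Measurable fun x : E3 × (E2 × ℝ) => frame (x.1 - p) (cyl x.2)
  exact measurable_frame.comp (f := fun x : E3 × (E2 × ℝ) => (x.1 - p, cyl x.2))
    ((measurable_fst.sub_const p).prodMk
    (cyl.continuous.measurable.comp measurable_snd))

theorem measurePreserving_height_add : MeasurePreserving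
    (fun y : (E3 × E2) × (ℝ × E3) => (y.1, (height p y.1.1 y.1.2 + y.2.1, y.2.2)))
    volume volume := by
  refine measurePreserving_family (α := E3 × E2) (β := ℝ × E3)
    (g := fun x v => (height p x.1 x.2 + v.1, v.2)) ?_ fun x => ?_
  · exact ((((measurable_height p).comp measurable_fst).add measurable_snd.fst)).prodMk
      measurable_snd.snd
  · exact (measurePreserving_add_left volume _).prod (MeasurePreserving.id volume)

theorem measurePreserving_pt (p' : E3) : MeasurePreserving (pt p p') volume volume :=
  (frame (p' - p)).measurePreserving.comp measurePreserving_cyl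

theorem measurePreserving_pt_family : MeasurePreserving
    (fun y : E3 × ((E2 × ℝ) × E3) => (y.1, (pt p y.1 y.2.1, y.2.2))) volume volume := by
  refine measurePreserving_family (α := E3) (β := (E2 × ℝ) × E3)
    (g := fun x v => (pt p x v.1, v.2)) ?_ fun x => ?_
  · exact ((measurable_pt p).comp
      (f := fun y : E3 × ((E2 × ℝ) × E3) => (y.1, y.2.1))
      (measurable_fst.prodMk measurable_snd.fst)).prodMk measurable_snd.snd
  · exact (measurePreserving_pt p x).prod (MeasurePreserving.id volume)

theorem measurePreserving_momentum : MeasurePreserving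
    (fun y : (E3 × E3) × E3 => (y.1, y.1.1 + y.1.2 - p + y.2)) volume volume := by
  refine measurePreserving_family (α := E3 × E3) (β := E3)
    (g := fun x v => x.1 + x.2 - p + v) ?_ fun x => ?_
  · fun_prop
  · exact measurePreserving_add_left volume _

/-- The chart is a composition of fibrewise translations and isometries, so there is no Jacobian.
Only measurability in the base variables is needed, and the behaviour at `p' = p` is harmless. -/
theorem measurePreserving_chart : MeasurePreserving (chart p) volume volume := by
  have h1 : MeasurePreserving (MeasurableEquiv.prodAssoc : (E3 × E2) × (ℝ × E3) ≃ᵐ _)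
      volume volume := volume_preserving_prodAssoc
  have h2 : MeasurePreserving (Prod.map id (MeasurableEquiv.prodAssoc.symm :
      E2 × (ℝ × E3) ≃ᵐ _) : E3 × (E2 × (ℝ × E3)) → _) volume volume :=
    (MeasurePreserving.id volume).prod volume_preserving_prodAssoc.symm
  have h3 : MeasurePreserving (MeasurableEquiv.prodAssoc.symm : E3 × (E3 × E3) ≃ᵐ _)
      volume volume := volume_preserving_prodAssoc.symm
  have h4 : MeasurePreserving (Prod.swap : (E3 × E3) × E3 → _) volume volume :=
    Measure.measurePreserving_swap
  have h5 : MeasurePreserving (Prod.map id Prod.swap : E3 × (E3 × E3) → _) volume volume :=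
    (MeasurePreserving.id volume).prod Measure.measurePreserving_swap
  exact h5.comp (h4.comp ((measurePreserving_momentum p).comp (h3.comp
    ((measurePreserving_pt_family p).comp (h2.comp
      (h1.comp (measurePreserving_height_add p)))))))

end Chart

/-! ### Linear changes of variables in the transverse coordinates. -/

section LinearChange

theorem measurePreserving_cons :
    MeasurePreserving (fun v : ℝ × E3 => (Fin.cons v.1 (fun i => v.2 i) : FourVec))
      volume volume := by
  have h1 := (MeasurePreserving.id (volume : Measure ℝ)).prod
    (EuclideanSpace.volume_preserving_symm_measurableEquiv_toLp (Fin 3))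
  have h2 := (volume_preserving_piFinSuccAbove (fun _ : Fin 4 => ℝ) 0).symm
  convert! h2.comp h1 using 1
  ext v i
  refine Fin.cases ?_ (fun j => ?_) i <;> simp [MeasurableEquiv.piFinSuccAbove]

theorem measurePreserving_shear (c : E3 → ℝ) (hc : Measurable c) :
    MeasurePreserving (fun v : ℝ × E3 => (v.1 + c v.2, v.2)) volume volume := by
  have h1 : MeasurePreserving (fun v : E3 × ℝ => (v.1, v.2 + c v.1)) volume volume := by
    refine measurePreserving_family
      (g := fun x t => t + c x) ?_ fun x => ?_
    · fun_prop
    · exact (measurePreserving_add_right volume _)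
  have h2 : MeasurePreserving (Prod.swap : E3 × ℝ → _) volume volume :=
    Measure.measurePreserving_swap
  have h3 : MeasurePreserving (Prod.swap : ℝ × E3 → _) volume volume :=
    Measure.measurePreserving_swap
  exact h2.comp (h1.comp h3)

/-- The linearized balance is triangular in `(t, u)`: the dependence of the energy on `u` is a shear
and costs nothing, and scaling `t` by `D` gives the factor `D⁻¹`. -/
theorem integral_cons_affine {η : FourVec → ℝ} (hη : Continuous η) {D : ℝ} (hD : 0 < D)
    (c : E3 → ℝ) (hc : Measurable c) :
    ∫ v : ℝ × E3, η (Fin.cons (v.1 * D + c v.2) (fun i => v.2 i)) = D⁻¹ * ∫ y, η y := by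
  have hT : Measurable fun v : ℝ × E3 => (v.1 * D, v.2) := by fun_prop
  have hmap : Measure.map (fun v : ℝ × E3 => (v.1 * D, v.2)) volume =
      ENNReal.ofReal D⁻¹ • volume := by
    have := Measure.map_prod_map (volume : Measure ℝ) (volume : Measure E3)
      (f := fun t => t * D) (g := id) (by fun_prop) measurable_id
    rw [Real.map_volume_mul_right hD.ne', Measure.map_id, Measure.prod_smul_left,
      abs_of_pos (inv_pos.2 hD)] at this
    exact this.symm
  have hΨ := measurePreserving_cons.comp (measurePreserving_shear c hc)
  have hm : StronglyMeasurable η := hη.stronglyMeasurable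
  calc ∫ v : ℝ × E3, η (Fin.cons (v.1 * D + c v.2) (fun i => v.2 i))
      = ∫ v : ℝ × E3, η (Fin.cons (v.1 + c v.2) (fun i => v.2 i))
          ∂(Measure.map (fun v : ℝ × E3 => (v.1 * D, v.2)) volume) := by
        rw [integral_map hT.aemeasurable]
        exact (hm.comp_measurable hΨ.measurable).aestronglyMeasurable
    _ = D⁻¹ * ∫ v : ℝ × E3, η (Fin.cons (v.1 + c v.2) (fun i => v.2 i)) := by
        rw [hmap, integral_smul_measure, ENNReal.toReal_ofReal (inv_pos.2 hD).le, smul_eq_mul]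
    _ = D⁻¹ * ∫ y, η y := by
        rw [← hΨ.map_eq, integral_map hΨ.measurable.aemeasurable
          hm.aestronglyMeasurable]
        rfl

/-- Rescaling of the last two of the coordinates. -/
theorem integral_comp_smul_snd {f : (E3 × E2) × (ℝ × E3) → ℝ} (hf : Measurable f) {ε : ℝ}
    (hε : 0 < ε) : ∫ y : (E3 × E2) × (ℝ × E3), f (y.1, ε • y.2) = (ε ^ 4)⁻¹ * ∫ y, f y := by
  have hT : Measurable fun y : (E3 × E2) × (ℝ × E3) => (y.1, ε • y.2) := by fun_prop
  have hmap : Measure.map (fun y : (E3 × E2) × (ℝ × E3) => (y.1, ε • y.2)) volume =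
      ENNReal.ofReal (ε ^ 4)⁻¹ • volume := by
    have := Measure.map_prod_map (volume : Measure (E3 × E2)) (volume : Measure (ℝ × E3))
      (f := id) (g := fun v => ε • v) measurable_id (by fun_prop)
    have hfr : Module.finrank ℝ (ℝ × E3) = 4 := by simp
    rw [show Measure.map (fun v : ℝ × E3 => ε • v) volume = _ from Measure.map_addHaar_smul
      ((volume : Measure ℝ).prod (volume : Measure E3)) hε.ne', hfr, Measure.map_id,
      Measure.prod_smul_right,
      abs_of_pos (by positivity)] at this
    exact this.symm
  rw [← integral_map (f := f) hT.aemeasurable hf.aestronglyMeasurable, hmap,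
    integral_smul_measure, ENNReal.toReal_ofReal (by positivity), smul_eq_mul]

end LinearChange

/-! ### Integrability of the singularity at `p' = p`. -/

section Inverse

/-- In polar coordinates the radial integrand is `r² · r⁻¹ = r`. -/
theorem integrableOn_inv_norm_sub (p : E3) (r : ℝ) :
    IntegrableOn (fun x : E3 => ‖x - p‖⁻¹) (Metric.ball p r) := by
  have h0 : IntegrableOn (fun x : E3 => ‖x‖⁻¹) (Metric.ball 0 r) := by
    rw [integrableOn_fun_norm_addHaar volume (f := fun t => t⁻¹)]
    have : IntegrableOn (fun y : ℝ => y) (Set.Ioo 0 r) :=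
      (continuous_id.integrableOn_Icc (a := 0) (b := r)).mono_set Set.Ioo_subset_Icc_self
    refine this.congr_fun (fun y hy => ?_) measurableSet_Ioo
    have : y ≠ 0 := hy.1.ne'
    simp only [finrank_euclideanSpace_fin, smul_eq_mul]
    field_simp
  have := (measurePreserving_sub_right (volume : Measure E3) p).integrableOn_comp_preimage
    (MeasurableEquiv.subRight p).measurableEmbedding (f := fun x : E3 => ‖x‖⁻¹)
    (s := Metric.ball 0 r)
  rw [← this] at h0
  convert! h0 using 1
  ext x
  simp [dist_eq_norm]

end Inverse

end RelBoltz

namespace RelBoltz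

open scoped RealInnerProductSpace

/-! ### The energy-momentum shell and the linearized balance. -/

section Shell

variable (p : E3)

/-- The point `(q, q', p')` of the energy-momentum shell with parameters `p'` and `w`. -/
noncomputable def shell (x : E3 × E2) : E3 × E3 × E3 :=
  (x.1 + surf p x.1 x.2 - p, surf p x.1 x.2, x.1)

/-- The density of the delta measure in the parameters `p'` and `w`. -/
noncomputable def shellDensity (x : E3 × E2) : ℝ :=
  energy (x.1 + surf p x.1 x.2 - p) * energy (surf p x.1 x.2) / root p x.1 x.2

theorem measurable_surf : Measurable fun x : E3 × E2 => surf p x.1 x.2 :=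
  (measurable_pt p).comp (f := fun x : E3 × E2 => (x.1, (x.2, height p x.1 x.2)))
    (measurable_fst.prodMk (measurable_snd.prodMk (measurable_height p)))

theorem measurable_shell : Measurable (shell p) :=
  ((measurable_fst.add (measurable_surf p)).sub_const p).prodMk
    ((measurable_surf p).prodMk measurable_fst)

theorem measurable_shellDensity : Measurable (shellDensity p) :=
  ((measurable_energy.comp ((measurable_fst.add (measurable_surf p)).sub_const p)).mul
    (measurable_energy.comp (measurable_surf p))).div (measurable_root p)

variable {p}

theorem shellDensity_pos {x : E3 × E2} (hx : x.1 ≠ p) : 0 < shellDensity p x :=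
  div_pos (mul_pos (energy_pos _) (energy_pos _)) (surf_identities hx x.2).1

/-- For fixed `(p', w)` the chart is affine: `t` moves `q` and `q'` together along the axis, and `u`
moves `q` alone. -/
theorem chart_smul (x : E3 × E2) (v : ℝ × E3) (ε : ℝ) :
    chart p (x, ε • v) = shell p x +
      ε • (v.1 • frame (x.1 - p) axis + v.2, v.1 • frame (x.1 - p) axis, (0 : E3)) := by
  have h : pt p x.1 (x.2, height p x.1 x.2 + ε * v.1) =
      surf p x.1 x.2 + ε • v.1 • frame (x.1 - p) axis := by
    have : cyl (x.2, height p x.1 x.2 + ε * v.1) =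
        cyl (x.2, height p x.1 x.2) + (ε * v.1) • axis := by
      ext i
      fin_cases i <;> simp [axis]
    rw [surf, pt, pt, this, map_add, map_smul, smul_smul]
  simp only [chart, shell, Prod.smul_fst, Prod.smul_snd, smul_eq_mul, h, Prod.smul_mk,
    Prod.mk_add_mk, smul_zero, add_zero, smul_add]
  congr 1
  abel

theorem balance_zero (x : E3 × E3 × E3) :
    balance p x 0 = energy p + energy x.1 - energy x.2.2 - energy x.2.1 := by
  simp [balance, fourMom]

theorem balance_succ (x : E3 × E3 × E3) (i : Fin 3) :
    balance p x i.succ = p i + x.1 i - x.2.2 i - x.2.1 i := by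
  simp [balance, fourMom]

theorem balance_chart_succ (y : (E3 × E2) × (ℝ × E3)) (i : Fin 3) :
    balance p (chart p y) i.succ = y.2.2 i := by
  simp only [balance_succ, chart, PiLp.add_apply, PiLp.sub_apply]
  ring

theorem balance_shell {x : E3 × E2} (hx : x.1 ≠ p) : balance p (shell p x) = 0 := by
  ext i
  refine Fin.cases ?_ (fun j => ?_) i
  · rw [balance_zero]
    simp [shell, energy_eq_of_layer_eq_zero (layer_surf hx x.2)]
  · simp [balance_succ, shell]

/-- The derivative of the energy balance across the collision surface. -/
theorem inner_velocity_sub {x : E3 × E2} (hx : x.1 ≠ p) :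
    (energy (x.1 + surf p x.1 x.2 - p))⁻¹ *
        ⟪x.1 + surf p x.1 x.2 - p, frame (x.1 - p) axis⟫ -
      (energy (surf p x.1 x.2))⁻¹ * ⟪surf p x.1 x.2, frame (x.1 - p) axis⟫ =
      (shellDensity p x)⁻¹ := by
  have hq := energy_eq_of_layer_eq_zero (layer_surf hx x.2)
  have hE := energy_pos (surf p x.1 x.2)
  have hE' := energy_pos (x.1 + surf p x.1 x.2 - p)
  obtain ⟨hr, -, h2⟩ := surf_identities hx x.2
  have ha := sub_ne_zero.2 hx
  have ha' := norm_pos_iff.2 ha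
  have h3 : ⟪surf p x.1 x.2, frame (x.1 - p) axis⟫ = height p x.1 x.2 := by
    rw [frame_axis ha, real_inner_smul_right, real_inner_comm, surf, pt, inner_frame_cyl ha]
    field_simp
  have h4 : ⟪x.1 + surf p x.1 x.2 - p, frame (x.1 - p) axis⟫ =
      ‖x.1 - p‖ + height p x.1 x.2 := by
    rw [add_sub_right_comm, inner_add_left, h3, frame_axis ha, real_inner_smul_right,
      real_inner_self_eq_norm_sq]
    field_simp
  rw [h3, h4, shellDensity, inv_div]
  field_simp
  rw [← h2, hq, gap]
  ring

/-- The balance vanishes on the shell, so the rescaled balance is a difference quotient and tends to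
the directional derivative. -/
theorem tendsto_balance_chart {x : E3 × E2} (hx : x.1 ≠ p) (v : ℝ × E3) :
    Tendsto (fun ε : ℝ => ε⁻¹ • balance p (chart p (x, ε • v))) (𝓝[>] 0)
      (𝓝 (Fin.cons (v.1 * (shellDensity p x)⁻¹ +
        (energy (x.1 + surf p x.1 x.2 - p))⁻¹ * ⟪x.1 + surf p x.1 x.2 - p, v.2⟫)
          fun i => v.2 i)) := by
  set e := frame (x.1 - p) axis with he
  have hline : ∀ q d : E3, HasDerivAt (fun ε : ℝ => energy (q + ε • d))
      ((energy q)⁻¹ * ⟪q, d⟫) 0 := by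
    intro q d
    have h1 : HasDerivAt (fun ε : ℝ => q + ε • d) d 0 := by
      simpa using ((hasDerivAt_id (0 : ℝ)).smul_const d).const_add q
    have h2 : HasFDerivAt energy ((energy q)⁻¹ • innerSL ℝ q) (q + (0 : ℝ) • d) := by
      simpa using hasFDerivAt_energy q
    exact h2.comp_hasDerivAt (0 : ℝ) h1
  have hd : HasDerivAt (fun ε : ℝ => balance p (chart p (x, ε • v)))
      (Fin.cons (v.1 * (shellDensity p x)⁻¹ +
        (energy (x.1 + surf p x.1 x.2 - p))⁻¹ * ⟪x.1 + surf p x.1 x.2 - p, v.2⟫)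
          fun i => v.2 i) 0 := by
    refine hasDerivAt_pi.2 fun i => ?_
    refine Fin.cases ?_ (fun j => ?_) i
    · have h1 := (((hline (x.1 + surf p x.1 x.2 - p) (v.1 • e + v.2)).const_add
        (energy p)).sub_const (energy x.1)).sub (hline (surf p x.1 x.2) (v.1 • e))
      convert! h1 using 1
      · funext ε
        rw [balance_zero, chart_smul]
        simp [shell, he]
      · rw [Fin.cons_zero, ← inner_velocity_sub hx, inner_add_right, real_inner_smul_right,
          real_inner_smul_right]
        ring
    · simp only [balance_chart_succ, Fin.cons_succ, Prod.smul_snd, PiLp.smul_apply, smul_eq_mul]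
      simpa using (hasDerivAt_id (0 : ℝ)).mul_const (v.2 j)
  have h0 : balance p (chart p (x, (0 : ℝ) • v)) = 0 := by
    rw [chart_smul, zero_smul, add_zero, balance_shell hx]
  have := hd.tendsto_slope_zero_right
  simpa only [zero_add, h0, sub_zero] using this

end Shell

/-! ### Uniform bounds and identification of the delta measure. -/

section Bounds

variable (p : E3)

/-- In rescaled coordinates, the support of the mollified delta function is bounded uniformly. -/
theorem exists_support_bound (R ρ : ℝ) : ∃ C : ℝ, ∀ (x : E3 × E2) (v : ℝ × E3) (ε : ℝ), 0 < ε →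
    x.1 ≠ p → ‖chart p (x, ε • v)‖ ≤ R → ‖ε⁻¹ • balance p (chart p (x, ε • v))‖ ≤ ρ →
    ‖x.1‖ ≤ R ∧ ‖x.2‖ ≤ R ∧ ‖v.2‖ ≤ 2 * ρ ∧ ‖x.1 - p‖ * |v.1| ≤ C := by
  set κ := energy p - ‖p‖ with hκ
  have hκ0 : 0 < κ := sub_pos.2 (norm_lt_energy p)
  -- A bound for the first factor in `energy_mul_eq_two_mul_layer`.
  set c := 4 * (1 + R) + 2 * energy p with hc
  refine ⟨3 * ρ * c * (energy p + (1 + R)) / κ, fun x v ε hε hx hR hρ => ?_⟩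
  obtain ⟨p', w⟩ := x
  obtain ⟨t, y⟩ := v
  simp only at hx ⊢
  set q' := pt p p' (w, height p p' w + ε * t) with hq'
  set q₀ := p' + q' - p with hq₀
  have hchart : chart p ((p', w), ε • (t, y)) = (q₀ + ε • y, q', p') := rfl
  rw [hchart] at hR hρ
  have hp'R : ‖p'‖ ≤ R := (norm_snd_le _).trans ((norm_snd_le _).trans hR)
  have hq'R : ‖q'‖ ≤ R := (norm_fst_le _).trans ((norm_snd_le (q₀ + ε • y, q', p')).trans hR)
  have hqR : ‖q₀ + ε • y‖ ≤ R := (norm_fst_le (q₀ + ε • y, q', p')).trans hR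
  have hR0 : 0 ≤ R := (norm_nonneg _).trans hp'R
  have hρ0 : 0 ≤ ρ := (norm_nonneg _).trans hρ
  have hw : ‖w‖ ≤ R := by
    refine le_trans ?_ hq'R
    rw [← sq_le_sq₀ (norm_nonneg _) (norm_nonneg _), hq', norm_pt_sq]
    simp only
    nlinarith [sq_nonneg (height p p' w + ε * t)]
  have hcomp : ∀ i, |balance p (q₀ + ε • y, q', p') i| ≤ ρ * ε := fun i => by
    have := (norm_le_pi_norm (ε⁻¹ • balance p (q₀ + ε • y, q', p')) i).trans hρ
    rw [Pi.smul_apply, norm_smul, norm_inv, Real.norm_eq_abs, Real.norm_eq_abs,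
      abs_of_pos hε, inv_mul_le_iff₀ hε] at this
    linarith
  have hyi : ∀ i, |y i| ≤ ρ := fun i => by
    have := hcomp i.succ
    rw [balance_succ] at this
    simp only [hq₀, PiLp.add_apply, PiLp.sub_apply, PiLp.smul_apply, smul_eq_mul] at this
    rw [show p i + (p' i + q' i - p i + ε * y i) - p' i - q' i = ε * y i by ring, abs_mul,
      abs_of_pos hε] at this
    nlinarith
  -- Three components of size at most `ρ`, and `√3 ≤ 2`.
  have hy : ‖y‖ ≤ 2 * ρ := by
    rw [← sq_le_sq₀ (norm_nonneg _) (by positivity), EuclideanSpace.norm_sq_eq,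
      Fin.sum_univ_three]
    have h := fun i => sq_le_sq' (neg_le_of_abs_le (hyi i)) (le_of_abs_le (hyi i))
    simp only [Real.norm_eq_abs, sq_abs]
    nlinarith [h 0, h 1, h 2, sq_nonneg ρ]
  refine ⟨hp'R, hw, hy, ?_⟩
  have h0 := hcomp 0
  rw [balance_zero] at h0
  simp only at h0
  have h1 : |energy q₀ - energy (q₀ + ε • y)| ≤ 2 * ρ * ε := by
    refine (abs_energy_sub_le _ _).trans ?_
    rw [sub_add_cancel_left, norm_neg, norm_smul, Real.norm_eq_abs, abs_of_pos hε]
    nlinarith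
  -- `ρ ε` from the energy component of the balance, and `2 ρ ε` from removing the momentum defect
  -- `ε • y`.
  have h2 : |energy q₀ - (energy p' + energy q' - energy p)| ≤ 3 * ρ * ε := by
    have := abs_add_le (energy q₀ - energy (q₀ + ε • y))
      (energy p + energy (q₀ + ε • y) - energy p' - energy q')
    rw [show energy q₀ - energy (q₀ + ε • y) +
      (energy p + energy (q₀ + ε • y) - energy p' - energy q') =
        energy q₀ - (energy p' + energy q' - energy p) by ring] at this
    linarith
  have hEp' := (energy_le p').trans (by linarith : 1 + ‖p'‖ ≤ 1 + R)
  have hEq' := (energy_le q').trans (by linarith : 1 + ‖q'‖ ≤ 1 + R)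
  have hEq₀ : energy q₀ ≤ 2 * (1 + R) + energy p := by
    have h3 : ‖q₀‖ ≤ 2 * R + ‖p‖ := by
      have h4 := norm_sub_le (p' + q') p
      have h5 := norm_add_le p' q'
      rw [← hq₀] at h4
      linarith
    have h4 := norm_lt_energy p
    linarith [energy_le q₀]
  have hsum : |energy q₀ + (energy p' + energy q' - energy p)| ≤ c := by
    have h3 := energy_pos p'
    have h4 := energy_pos q'
    have h5 := energy_pos q₀
    have h6 := energy_pos p
    rw [abs_le]
    constructor <;> linarith
  have hlayer : |layer p p' q'| ≤ 3 * ρ * c * ε := by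
    have h3 := energy_mul_eq_two_mul_layer p p' q'
    rw [← hq₀] at h3
    have h4 : 2 * |layer p p' q'| ≤ c * (3 * ρ * ε) := by
      rw [← abs_two, ← abs_mul, ← h3, abs_mul]
      exact mul_le_mul hsum h2 (abs_nonneg _) ((abs_nonneg _).trans hsum)
    nlinarith [abs_nonneg (layer p p' q')]
  have h3 := (le_abs_layer_pt hx w (ε * t)).trans hlayer
  rw [abs_mul, abs_of_pos hε] at h3
  have h4 : (‖p' - p‖ - |gap p p'|) * |t| ≤ 3 * ρ * c := by
    have : ε * ((‖p' - p‖ - |gap p p'|) * |t|) ≤ ε * (3 * ρ * c) := by linarith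
    exact le_of_mul_le_mul_left this hε
  have h5 := mul_le_norm_sub_sub_abs p p'
  have h6 : ‖p' - p‖ * (κ / (energy p + (1 + R))) ≤ ‖p' - p‖ - |gap p p'| := by
    refine le_trans ?_ h5
    have := energy_pos p
    have := energy_pos p'
    gcongr
  rw [le_div_iff₀ hκ0]
  have h7 : ‖p' - p‖ * (κ / (energy p + (1 + R))) * |t| ≤ 3 * ρ * c :=
    (mul_le_mul_of_nonneg_right h6 (abs_nonneg t)).trans h4
  have h8 : 0 < energy p + (1 + R) := by have := energy_pos p; positivity
  have h9 : ‖p' - p‖ * (κ / (energy p + (1 + R))) * |t| =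
      (‖p' - p‖ * |t| * κ) / (energy p + (1 + R)) := by ring
  rwa [h9, div_le_iff₀ h8] at h7

/-- An integrable majorant in the parameters `p'` and `w`. -/
noncomputable def majorant (R : ℝ) (x : E3 × E2) : ℝ :=
  (Metric.closedBall 0 R).indicator (fun x => ‖x - p‖⁻¹) x.1 *
    (Metric.closedBall 0 R).indicator (fun _ => 1) x.2

theorem integrable_majorant (R : ℝ) : Integrable (majorant p R) volume := by
  refine Integrable.mul_prod (f := (Metric.closedBall (0 : E3) R).indicator fun x => ‖x - p‖⁻¹)
    (g := (Metric.closedBall (0 : E2) R).indicator fun _ => (1 : ℝ)) ?_ ?_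
  · rw [integrable_indicator_iff measurableSet_closedBall]
    refine (integrableOn_inv_norm_sub p (R + ‖p‖ + 1)).mono_set fun x hx => ?_
    rw [mem_closedBall_zero_iff] at hx
    rw [Metric.mem_ball, dist_eq_norm]
    linarith [norm_sub_le x p]
  · rw [integrable_indicator_iff measurableSet_closedBall]
    exact integrableOn_const measure_closedBall_lt_top.ne

/-- A set that contains the supports of all the rescaled integrands. -/
def bigSet (R r C : ℝ) : Set ((E3 × E2) × (ℝ × E3)) :=
  {y | ‖y.1.1‖ ≤ R ∧ ‖y.1.2‖ ≤ R ∧ ‖y.2.2‖ ≤ r ∧ ‖y.1.1 - p‖ * |y.2.1| ≤ C}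

theorem measurableSet_bigSet (R r C : ℝ) : MeasurableSet (bigSet p R r C) := by
  have h1 : IsClosed {y : (E3 × E2) × (ℝ × E3) | ‖y.1.1‖ ≤ R} :=
    isClosed_le (by fun_prop) (by fun_prop)
  have h2 : IsClosed {y : (E3 × E2) × (ℝ × E3) | ‖y.1.2‖ ≤ R} :=
    isClosed_le (by fun_prop) (by fun_prop)
  have h3 : IsClosed {y : (E3 × E2) × (ℝ × E3) | ‖y.2.2‖ ≤ r} :=
    isClosed_le (by fun_prop) (by fun_prop)
  have h4 : IsClosed {y : (E3 × E2) × (ℝ × E3) | ‖y.1.1 - p‖ * |y.2.1| ≤ C} :=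
    isClosed_le (by fun_prop) (by fun_prop)
  exact (h1.inter (h2.inter (h3.inter h4))).measurableSet

theorem ae_fst_ne : ∀ᵐ x : E3 × E2, x.1 ≠ p := by
  have h : ∀ᵐ p' : E3, p' ≠ p := by simp [ae_iff]
  exact (Measure.quasiMeasurePreserving_fst (μ := (volume : Measure E3))
    (ν := (volume : Measure E2))).ae h

/-- The set is unbounded in `t` as `p' → p`, but its `t`-fibres have length at most `2 C / |p' -
p|`, which is integrable over bounded `p'`. -/
theorem volume_bigSet_lt_top (R r C : ℝ) : volume (bigSet p R r C) < ∞ := by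
  rw [Measure.volume_eq_prod, Measure.prod_apply (measurableSet_bigSet p R r C)]
  have hfin := (integrable_majorant p R).lintegral_lt_top
  have hle : ∀ᵐ x : E3 × E2, volume (Prod.mk x ⁻¹' bigSet p R r C) ≤
      ENNReal.ofReal (majorant p R x) *
        (ENNReal.ofReal (2 * C) * volume (Metric.closedBall (0 : E3) r)) := by
    filter_upwards [ae_fst_ne p] with x hx
    have ha : 0 < ‖x.1 - p‖ := norm_pos_iff.2 (sub_ne_zero.2 hx)
    by_cases h : ‖x.1‖ ≤ R ∧ ‖x.2‖ ≤ R
    · have hG : majorant p R x = ‖x.1 - p‖⁻¹ := by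
        rw [majorant, Set.indicator_of_mem (mem_closedBall_zero_iff.2 h.1),
          Set.indicator_of_mem (mem_closedBall_zero_iff.2 h.2), mul_one]
      have hsub : Prod.mk x ⁻¹' bigSet p R r C ⊆
          Metric.closedBall 0 (‖x.1 - p‖⁻¹ * C) ×ˢ Metric.closedBall 0 r := by
        rintro v ⟨-, -, h1, h2⟩
        refine ⟨?_, mem_closedBall_zero_iff.2 h1⟩
        rw [mem_closedBall_zero_iff, Real.norm_eq_abs, le_inv_mul_iff₀ ha]
        exact h2
      refine (measure_mono hsub).trans ?_
      rw [Measure.volume_eq_prod, Measure.prod_prod, Real.volume_closedBall, hG,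
        ← mul_assoc (ENNReal.ofReal _),
        ← ENNReal.ofReal_mul (inv_nonneg.2 ha.le)]
      refine le_of_eq ?_
      congr 2
      ring
    · have : Prod.mk x ⁻¹' bigSet p R r C = ∅ := by
        ext v
        simp only [Set.mem_preimage, Set.mem_empty_iff_false, iff_false]
        exact fun hv => h ⟨hv.1, hv.2.1⟩
      rw [this]; simp
  refine (lintegral_mono_ae hle).trans_lt ?_
  have hc : ENNReal.ofReal (2 * C) * volume (Metric.closedBall (0 : E3) r) < ∞ :=
    ENNReal.mul_lt_top ENNReal.ofReal_lt_top measure_closedBall_lt_top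
  rw [lintegral_mul_const' _ _ hc.ne]
  exact ENNReal.mul_lt_top hfin hc

/-- The energy-momentum delta measure in the parameters `p'` and `w`. -/
noncomputable def shellMeasure : Measure (E3 × E3 × E3) :=
  (volume.withDensity fun x => ENNReal.ofReal (shellDensity p x)).map (shell p)

/-- By `surf_identities` and `|height| ≤ q'⁰`, `root ≥ (|p' - p| - |gap|) q'⁰`. The factor `q'⁰`
cancels, and the bracket is at least a constant multiple of `|p' - p|` by `mul_le_norm_sub_sub_abs`.
-/
theorem shellDensity_le {R : ℝ} {x : E3 × E2} (hx : x.1 ≠ p) (hR : ‖shell p x‖ ≤ R) :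
    shellDensity p x ≤ (1 + R) * (energy p + (1 + R)) / (energy p - ‖p‖) * majorant p R x := by
  have hκ0 : 0 < energy p - ‖p‖ := sub_pos.2 (norm_lt_energy p)
  obtain ⟨hr, -, h2⟩ := surf_identities hx x.2
  have ha : 0 < ‖x.1 - p‖ := norm_pos_iff.2 (sub_ne_zero.2 hx)
  have hE := energy_pos (surf p x.1 x.2)
  have h1 : ‖x.1‖ ≤ R := (norm_snd_le _).trans ((norm_snd_le _).trans hR)
  have h3 : ‖surf p x.1 x.2‖ ≤ R := (norm_fst_le _).trans ((norm_snd_le (shell p x)).trans hR)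
  have h4 : ‖x.1 + surf p x.1 x.2 - p‖ ≤ R := (norm_fst_le (shell p x)).trans hR
  have hR0 : 0 ≤ R := (norm_nonneg _).trans h1
  have hz : |height p x.1 x.2| ≤ ‖surf p x.1 x.2‖ := by
    rw [← abs_norm, ← sq_le_sq, surf, norm_pt_sq]
    nlinarith [sq_nonneg ‖x.2‖]
  have hw : ‖x.2‖ ≤ ‖surf p x.1 x.2‖ := by
    rw [← sq_le_sq₀ (norm_nonneg _) (norm_nonneg _), surf, norm_pt_sq]
    nlinarith [sq_nonneg (height p x.1 x.2)]
  have hG : majorant p R x = ‖x.1 - p‖⁻¹ := by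
    rw [majorant, Set.indicator_of_mem (mem_closedBall_zero_iff.2 h1),
      Set.indicator_of_mem (mem_closedBall_zero_iff.2 (hw.trans h3)), mul_one]
  have h5 : (‖x.1 - p‖ - |gap p x.1|) * energy (surf p x.1 x.2) ≤ root p x.1 x.2 := by
    have h6 : gap p x.1 * height p x.1 x.2 ≤ |gap p x.1| * energy (surf p x.1 x.2) := by
      refine (le_abs_self _).trans ?_
      rw [abs_mul]
      have := hz.trans (norm_lt_energy _).le
      gcongr
    linarith
  have h7 : ‖x.1 - p‖ * ((energy p - ‖p‖) / (energy p + (1 + R))) ≤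
      ‖x.1 - p‖ - |gap p x.1| := by
    refine le_trans ?_ (mul_le_norm_sub_sub_abs p x.1)
    have := energy_pos p
    have := energy_pos x.1
    have := (energy_le x.1).trans (by linarith : 1 + ‖x.1‖ ≤ 1 + R)
    gcongr
  have hp := energy_pos p
  have h8 : ‖x.1 - p‖ * ((energy p - ‖p‖) / (energy p + (1 + R))) * energy (surf p x.1 x.2) ≤
      root p x.1 x.2 := (mul_le_mul_of_nonneg_right h7 hE.le).trans h5
  have h9 : energy (x.1 + surf p x.1 x.2 - p) ≤ 1 + R := (energy_le _).trans (by linarith)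
  rw [hG, shellDensity, div_le_iff₀ hr]
  calc energy (x.1 + surf p x.1 x.2 - p) * energy (surf p x.1 x.2)
      ≤ (1 + R) * energy (surf p x.1 x.2) := by gcongr
    _ = (1 + R) * (energy p + (1 + R)) / (energy p - ‖p‖) * ‖x.1 - p‖⁻¹ *
          (‖x.1 - p‖ * ((energy p - ‖p‖) / (energy p + (1 + R))) *
            energy (surf p x.1 x.2)) := by
        field_simp
    _ ≤ _ := by gcongr

theorem isFiniteMeasureOnCompacts_shellMeasure : IsFiniteMeasureOnCompacts (shellMeasure p) := by
  refine ⟨fun K hK => ?_⟩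
  obtain ⟨R, hR⟩ := hK.isBounded.exists_norm_le
  have hKm := hK.measurableSet
  rw [shellMeasure, Measure.map_apply (measurable_shell p) hKm,
    withDensity_apply _ (measurable_shell p hKm)]
  set c := (1 + R) * (energy p + (1 + R)) / (energy p - ‖p‖)
  refine lt_of_le_of_lt ?_ ((integrable_majorant p R).const_mul c).lintegral_lt_top
  refine (setLIntegral_mono_ae' (measurable_shell p hKm) ?_).trans
    (setLIntegral_le_lintegral (shell p ⁻¹' K) _)
  filter_upwards [ae_fst_ne p] with x hx hxK
  exact ENNReal.ofReal_le_ofReal (shellDensity_le p hx (hR _ hxK))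

/-- The energy-momentum delta function is carried by the shell. -/
theorem isDeltaMeasure_shellMeasure :
    IsDeltaMeasure (volume : Measure (E3 × E3 × E3)) (balance p) (shellMeasure p) := by
  refine ⟨isFiniteMeasureOnCompacts_shellMeasure p, fun η hη hηc hη0 hη1 φ hφ hφc => ?_⟩
  obtain ⟨R, hR⟩ := hφc.isCompact.isBounded.exists_norm_le
  obtain ⟨ρ, hρ⟩ := hηc.isCompact.isBounded.exists_norm_le
  obtain ⟨M, hM⟩ := hφc.exists_bound_of_continuous hφ
  obtain ⟨N, hN⟩ := hηc.exists_bound_of_continuous hη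
  obtain ⟨C, hC⟩ := exists_support_bound p R ρ
  have hbal : Continuous (balance p) := by
    have := continuous_fourMom
    unfold balance
    fun_prop
  have hchart := measurePreserving_chart p
  set H : ℝ → (E3 × E2) × (ℝ × E3) → ℝ := fun ε y =>
    φ (chart p (y.1, ε • y.2)) * η (ε⁻¹ • balance p (chart p (y.1, ε • y.2))) with hH
  set H₀ : (E3 × E2) × (ℝ × E3) → ℝ := fun y => φ (shell p y.1) *
    η (Fin.cons (y.2.1 * (shellDensity p y.1)⁻¹ +
      (energy (y.1.1 + surf p y.1.1 y.1.2 - p))⁻¹ *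
        ⟪y.1.1 + surf p y.1.1 y.1.2 - p, y.2.2⟫) fun i => y.2.2 i) with hH₀
  have hae : ∀ᵐ y : (E3 × E2) × (ℝ × E3), y.1.1 ≠ p :=
    (Measure.quasiMeasurePreserving_fst (μ := (volume : Measure (E3 × E2)))
      (ν := (volume : Measure (ℝ × E3)))).ae (ae_fst_ne p)
  have hHm : ∀ ε, Measurable (H ε) := fun ε => by
    have h1 : Measurable fun y : (E3 × E2) × (ℝ × E3) => chart p (y.1, ε • y.2) :=
      hchart.measurable.comp (measurable_fst.prodMk (measurable_snd.const_smul ε))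
    exact (hφ.measurable.comp h1).mul
      (hη.measurable.comp ((hbal.measurable.comp h1).const_smul ε⁻¹))
  -- Passing to the chart costs no Jacobian, and scaling the four coordinates `(t, u)` by `ε`
  -- absorbs `ε⁻⁴`.
  have hrescale : ∀ ε : ℝ, 0 < ε →
      ∫ x, φ x * ((ε ^ 4)⁻¹ * η (ε⁻¹ • balance p x)) = ∫ y, H ε y := by
    intro ε hε
    have hf : Continuous fun x : E3 × E3 × E3 => φ x * η (ε⁻¹ • balance p x) := by fun_prop
    have h1 : ∫ y, H ε y = (ε ^ 4)⁻¹ * ∫ y, φ (chart p y) * η (ε⁻¹ • balance p (chart p y)) :=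
      integral_comp_smul_snd (f := fun y => φ (chart p y) * η (ε⁻¹ • balance p (chart p y)))
        (hf.measurable.comp hchart.measurable) hε
    rw [h1, ← integral_map (μ := volume) hchart.measurable.aemeasurable
      (f := fun x => φ x * η (ε⁻¹ • balance p x)) hf.aestronglyMeasurable, hchart.map_eq,
      ← integral_const_mul]
    congr 1
    funext x
    ring
  set b : (E3 × E2) × (ℝ × E3) → ℝ := (bigSet p R (2 * ρ) C).indicator fun _ => M * N
  have hb : Integrable b volume := by
    rw [integrable_indicator_iff (measurableSet_bigSet p _ _ _)]
    exact integrableOn_const (volume_bigSet_lt_top p _ _ _).ne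
  have hM0 : 0 ≤ M := (norm_nonneg _).trans (hM 0)
  have hN0 : 0 ≤ N := (norm_nonneg _).trans (hN 0)
  have hbound : ∀ ε : ℝ, 0 < ε → ∀ y : (E3 × E2) × (ℝ × E3), y.1.1 ≠ p → ‖H ε y‖ ≤ b y := by
    intro ε hε y hy
    by_cases h : H ε y = 0
    · rw [h, norm_zero]
      exact Set.indicator_nonneg (fun _ _ => mul_nonneg hM0 hN0) _
    · have h1 := left_ne_zero_of_mul h
      have h2 := right_ne_zero_of_mul h
      have hmem : y ∈ bigSet p R (2 * ρ) C := hC y.1 y.2 ε hε hy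
        (hR _ (subset_tsupport _ h1)) (hρ _ (subset_tsupport _ h2))
      have hby : b y = M * N := Set.indicator_of_mem hmem _
      rw [hby, norm_mul]
      exact mul_le_mul (hM _) (hN _) (norm_nonneg _) hM0
  have hlim : ∀ y : (E3 × E2) × (ℝ × E3), y.1.1 ≠ p →
      Tendsto (fun ε => H ε y) (𝓝[>] 0) (𝓝 (H₀ y)) := by
    intro y hy
    refine Tendsto.mul ?_ ((hη.tendsto _).comp (tendsto_balance_chart hy y.2))
    refine (hφ.tendsto _).comp ?_
    have h1 : Continuous fun ε : ℝ => chart p (y.1, ε • y.2) := by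
      simp only [chart_smul]
      fun_prop
    have h2 := h1.tendsto 0
    rw [chart_smul, zero_smul, add_zero] at h2
    exact h2.mono_left nhdsWithin_le_nhds
  have hpos : ∀ᶠ ε : ℝ in 𝓝[>] 0, 0 < ε := self_mem_nhdsWithin
  have hmain : Tendsto (fun ε => ∫ y, H ε y) (𝓝[>] 0) (𝓝 (∫ y, H₀ y)) := by
    refine tendsto_integral_filter_of_dominated_convergence b
      (Eventually.of_forall fun ε => (hHm ε).aestronglyMeasurable) ?_ hb ?_
    · filter_upwards [hpos] with ε hε
      filter_upwards [hae] with y hy using hbound ε hε y hy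
    · filter_upwards [hae] with y hy using hlim y hy
  have hH₀i : Integrable H₀ volume := by
    refine hb.mono' (aestronglyMeasurable_of_tendsto_ae (𝓝[>] (0 : ℝ))
      (fun ε => (hHm ε).aestronglyMeasurable) ?_) ?_
    · filter_upwards [hae] with y hy using hlim y hy
    · filter_upwards [hae] with y hy
      refine le_of_tendsto (hlim y hy).norm ?_
      filter_upwards [hpos] with ε hε using hbound ε hε y hy
  -- By Fubini, integrating out `(t, u)` uses `∫ η = 1` and leaves the inverse of the `t`-derivative
  -- of the energy balance, which is `shellDensity`.
  have hval : ∫ y, H₀ y = ∫ x, φ x ∂(shellMeasure p) := by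
    rw [shellMeasure, integral_map (measurable_shell p).aemeasurable hφ.aestronglyMeasurable,
      integral_withDensity_eq_integral_toReal_smul (measurable_shellDensity p).ennreal_ofReal
        (ae_of_all _ fun _ => ENNReal.ofReal_lt_top)]
    rw [Measure.volume_eq_prod] at hH₀i ⊢
    rw [integral_prod _ hH₀i]
    refine integral_congr_ae ?_
    filter_upwards [ae_fst_ne p] with x hx
    have hd := shellDensity_pos hx
    have := integral_cons_affine hη (inv_pos.2 hd)
      (fun y => (energy (x.1 + surf p x.1 x.2 - p))⁻¹ * ⟪x.1 + surf p x.1 x.2 - p, y⟫)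
      (by fun_prop)
    rw [hη1, mul_one, inv_inv] at this
    simp only [hH₀]
    rw [integral_const_mul, this, ENNReal.toReal_ofReal hd.le, smul_eq_mul, mul_comm]
  rw [← hval]
  refine hmain.congr' ?_
  filter_upwards [hpos] with ε hε using (hrescale ε hε).symm

end Bounds

end RelBoltz

namespace RelBoltz

/-! ### Comparison of the gain integral with the surface integral. -/

theorem lintegral_shellMeasure (p : E3) {F : E3 × E3 × E3 → ℝ≥0∞} (hF : Measurable F) :
    ∫⁻ x, F x ∂(shellMeasure p) =
      ∫⁻ p' : E3, ∫⁻ w : E2, ENNReal.ofReal (shellDensity p (p', w)) * F (shell p (p', w)) := by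
  rw [shellMeasure, lintegral_map hF (measurable_shell p),
    lintegral_withDensity_eq_lintegral_mul _ (measurable_shellDensity p).ennreal_ofReal
      (g := fun x => F (shell p x)) (hF.comp (measurable_shell p)), Measure.volume_eq_prod, lintegral_prod]
  · rfl
  · exact ((measurable_shellDensity p).ennreal_ofReal.mul
      (hF.comp (measurable_shell p))).aemeasurable

theorem continuous_lorentz : Continuous fun x : FourVec × FourVec => lorentz x.1 x.2 := by
  unfold lorentz
  fun_prop

theorem measurable_rate {σ : ℝ → ℝ → ℝ≥0} (hσ : Measurable (Function.uncurry σ)) (p : E3) :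
    Measurable fun x : E3 × E3 × E3 =>
      rate σ (fourMom p) (fourMom x.1) (fourMom x.2.2) (fourMom x.2.1) := by
  have hm := continuous_fourMom
  have hs : Measurable fun x : E3 × E3 × E3 => sInv (fourMom p) (fourMom x.1) :=
    (continuous_lorentz.comp (f := fun x : E3 × E3 × E3 =>
      (fourMom p + fourMom x.1, fourMom p + fourMom x.1)) (by fun_prop)).neg.measurable
  have hg : Measurable fun x : E3 × E3 × E3 => gInv (fourMom p) (fourMom x.1) :=
    (continuous_lorentz.comp (f := fun x : E3 × E3 × E3 =>
      (fourMom p - fourMom x.1, fourMom p - fourMom x.1)) (by fun_prop)).measurable.sqrt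
  have hl : Measurable fun x : E3 × E3 × E3 =>
      lorentz (fourMom p - fourMom x.1) (fourMom x.2.2 - fourMom x.2.1) :=
    (continuous_lorentz.comp (f := fun x : E3 × E3 × E3 =>
      (fourMom p - fourMom x.1, fourMom x.2.2 - fourMom x.2.1)) (by fun_prop)).measurable
  have ht : Measurable fun x : E3 × E3 × E3 =>
      scatAngle (fourMom p) (fourMom x.1) (fourMom x.2.2) (fourMom x.2.1) :=
    Real.measurable_arccos.comp (hl.div (hg.pow_const 2))
  exact (hs.const_mul _).mul (hσ.comp (hg.prodMk ht)).coe_nnreal_real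

theorem fourMom_eq_qVec {p p' q' : E3} (h : layer p p' q' = 0) :
    fourMom (p' + q' - p) = qVec p p' q' := by
  ext i
  refine Fin.cases ?_ (fun j => ?_) i
  · simpa [fourMom, qVec] using energy_eq_of_layer_eq_zero h
  · simp [fourMom, qVec]

end RelBoltz

open RelBoltz in
theorem proposition5p1 (σ : ℝ → ℝ → ℝ≥0) (hσ : Measurable (Function.uncurry σ))
    (f : RelBoltz.E3 → ℝ≥0) (hf : Measurable f) (p : RelBoltz.E3) :
    RelBoltz.gain σ f f p =
      ENNReal.ofReal (1 / (2 * RelBoltz.energy p)) *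
        ∫⁻ p' : RelBoltz.E3, ENNReal.ofReal (f p' / RelBoltz.energy p') *
          ∫⁻ q' in RelBoltz.collSurface p p',
            ENNReal.ofReal
              (RelBoltz.sInv (RelBoltz.fourMom p) (RelBoltz.qVec p p' q') *
                  σ (RelBoltz.gInv (RelBoltz.fourMom p) (RelBoltz.qVec p p' q'))
                    (RelBoltz.scatAngle (RelBoltz.fourMom p) (RelBoltz.qVec p p' q')
                      (RelBoltz.fourMom p') (RelBoltz.fourMom q')) *
                  RelBoltz.stepFn
                    (RelBoltz.energy p' + RelBoltz.energy q' - RelBoltz.energy p) *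
                  f q' /
                (RelBoltz.energy q' * RelBoltz.layerDenom p p' q'))
            ∂(μHE[2] : Measure RelBoltz.E3) := by
  have hE := measurable_energy
  have hF : Measurable fun x : E3 × E3 × E3 => ENNReal.ofReal
      (rate σ (fourMom p) (fourMom x.1) (fourMom x.2.2) (fourMom x.2.1) * f x.2.2 * f x.2.1 /
        (energy x.1 * energy x.2.1 * energy x.2.2)) := by
    have := measurable_rate hσ p
    fun_prop
  have hp := energy_pos p
  rw [gain, (isDeltaMeasure_shellMeasure p).deltaMeasure_eq, lintegral_shellMeasure p hF,
    show 1 / (2 * energy p) = 1 / energy p * (1 / 2) by field_simp,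
    ENNReal.ofReal_mul (by positivity), mul_assoc,
    ← lintegral_const_mul' (ENNReal.ofReal (1 / 2)) _ ENNReal.ofReal_ne_top]
  congr 1
  refine lintegral_congr_ae ?_
  -- At `p' = p` the collision surface degenerates to all of `ℝ³`, but this is a single value of
  -- `p'`.
  have hne : ∀ᵐ p' : E3, p' ≠ p := by simp [ae_iff]
  filter_upwards [hne] with p' hp'
  rw [lintegral_collSurface hp', ← mul_assoc,
    ← lintegral_const_mul' _ _ (ENNReal.mul_ne_top ENNReal.ofReal_ne_top ENNReal.ofReal_ne_top)]
  refine lintegral_congr fun w => ?_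
  have hl := layer_surf hp' w
  have hq := energy_eq_of_layer_eq_zero hl
  have hEq := energy_pos (p' + surf p p' w - p)
  have hEq' := energy_pos (surf p p' w)
  have hEp' := energy_pos p'
  have hr := (surf_identities hp' w).1
  have hd := layerDenom_surf hp' w
  -- On the surface the argument of the step function is the energy of `q`, hence positive.
  have hu : stepFn (energy p' + energy (surf p p' w) - energy p) = 1 :=
    if_pos (hq ▸ hEq)
  simp only [shell, fourMom_eq_qVec hl]
  rw [hu, hd, ← ENNReal.ofReal_mul (shellDensity_pos (x := (p', w)) hp').le,
    ← ENNReal.ofReal_mul (by positivity), ← ENNReal.ofReal_mul (Real.sqrt_nonneg _),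
    ← ENNReal.ofReal_mul (by positivity)]
  congr 1
  have hJ : 0 < Real.sqrt (1 + (gap p p' / root p p' w) ^ 2 * ‖w‖ ^ 2) :=
    Real.sqrt_pos.2 (by positivity)
  -- The factor `q⁰` of the density cancels the weight `1 / q⁰`, and the area factor cancels the one
  -- in `layerDenom_surf`.
  rw [rate, shellDensity]
  field_simp
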